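/- Consider the types of System F extended with finite sums, finite products and fixpoints, $$A,B ::= X \mid A\Rightarrow B \mid \forall X.A \mid 1 \mid 0 \mid A\times B \mid A+B \mid \mu X.A \mid \nu X.A ,$$ taken up to renaming of bound variables, where $\mu X.A$ and $\nu X.A$ are formed only if $X$ has only positive free occurrences in $A$. (An occurrence of a variable is positive or negative according to whether it lies to the left of an even or an odd number of arrows.) For a list $(A_i)_{i\in L}$ write $\langle A_i\rangle_{i\in L}\Rightarrow B$ for $A_{i_1}\Rightarrow\dots\Rightarrow A_{i_k}\Rightarrow B$; the empty product is $1$, the empty sum is $0$; and $\exists\vec Z.A$ stands for $\forall Y'.(\forall \vec Z.(A\Rightarrow Y'))\Rightarrow Y'$ if $\vec Z$ is non-empty and for $A$ if $\vec Z$ is empty. Let $\equiv_{\mathsf Y}$ be the least congruence on these types (that is, the least equivalence relation compatible with all type constructors) containing all instances of the following schemas. 1. $\beta\eta$-isomorphisms: - $A\Rightarrow(B\Rightarrow C)\equiv B\Rightarrow(A\Rightarrow C)$; $\ \forall X.\forall Y.A\equiv\forall Y.\forall X.A$; $\ A\equiv\forall X.A$ and $A\Rightarrow\forall X.B\equiv\forall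 X.(A\Rightarrow B)$ if $X$ is not free in $A$; - $A\times 1\equiv A$; $\ 1\Rightarrow A\equiv A$; $\ A\times(B\times C)\equiv(A\times B)\times C$; $\ A\times B\equiv B\times A$; $\ (A\times B)\Rightarrow C\equiv A\Rightarrow(B\Rightarrow C)$; $\ \forall X.(A\times B)\equiv(\forall X.A)\times(\forall X.B)$; - $A+0\equiv A$; $\ A\times 0\equiv 0$; $\ 0\Rightarrow A\equiv 1$; $\ A+(B+C)\equiv(A+B)+C$; $\ A+B\equiv B+A$; $\ A\times(B+C)\equiv(A\times B)+(A\times C)$; $\ (A+B)\Rightarrow C\equiv(A\Rightarrow C)\times(B\Rightarrow C)$; - $\mu X.A\equiv A$ and $\nu X.A\equiv A$ if $X$ is not free in $A$; $\ \mu X.A\equiv A[\mu X.A/X]$ and $\nu X.A\equiv A[\nu X.A/X]$. 2. Yoneda type isomorphisms, for finite, possibly empty, lists of indices $k$, $j$ and of variables $\vec Y,\vec Z_k$: $$\forall X.\forall\vec Y.\big\langle \forall\vec Z_k.\langle A_{jk}\rangle_j\Rightarrow X\big\rangle_k\Rightarrow B\ \equiv\ \forall\vec Y.\,B\big[\{\mu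 X.\}\textstyle\sum_k\exists\vec Z_k.\prod_j A_{jk}\,/\,X\big]$$ if $X$ has only positive free occurrences in all $A_{jk}$ and in $B$; and $$\forall X.\forall\vec Y.\big\langle \forall\vec Z_k.\,X\Rightarrow A_k\big\rangle_k\Rightarrow B\ \equiv\ \forall\vec Y.\,B\big[\{\nu X.\}\textstyle\prod_k\forall\vec Z_k.A_k\,/\,X\big]$$ if $X$ has only positive free occurrences in all $A_k$ and only negative free occurrences in $B$. Here $\{\mu X.\}$ (resp. $\{\nu X.\}$) means that the binder is present only if $X$ actually occurs free in some $A_{jk}$ (resp. $A_k$). A simple type is a type built from variables by $\Rightarrow$ only. It is inhabited if it is the type of a closed term of the simply typed $\lambda$-calculus. It is balanced if every variable occurring in it occurs exactly once positively and exactly once negatively, and negatively non-duplicated if no variable has two or more negative occurrences in it. **Proposition.** Let $A$ be an inhabited simple type whose free variables are among $X_1,\dots,X_n$. If $A$ is balanced or negatively non-duplicated, then $\forall X_1\dots\forall X_n.A\equiv_{\mathsf Y}1$. -/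

import Mathlib

/-! ### Types of System F with `0, 1, +, ×` and least/greatest fixpoints

Types are taken up to renaming of bound variables, in de Bruijn style: `var i` is the variable bound
by the `i`-th enclosing binder (counted from the inside); indices that exceed the number of enclosing
binders are free variables. -/

/-- Raw types. The positivity condition on `μ X. A` and `ν X. A` is `FType.WF` below. -/
inductive FType : Type
  | var : ℕ → FType
  | arr : FType → FType → FType
  | all : FType → FType
  | one : FType
  | zero : FType
  | prod : FType → FType → FType
  | sum : FType → FType → FType
  | mu : FType → FType
  | nu : FType → FType

namespace FType

/-- `A.occ true i` (resp. `A.occ false i`) says that the variable `i` has a free positive (resp.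
negative) occurrence in `A`. -/
def occ : FType → Bool → ℕ → Bool
  | var j, b, i => b && decide (i = j)
  | arr A B, b, i => A.occ (!b) i || B.occ b i
  | all A, b, i => A.occ b (i + 1)
  | one, _, _ => false
  | zero, _, _ => false
  | prod A B, b, i => A.occ b i || B.occ b i
  | sum A B, b, i => A.occ b i || B.occ b i
  | mu A, b, i => A.occ b (i + 1)
  | nu A, b, i => A.occ b (i + 1)

/-- All free occurrences of the variable `i` in `A` are positive. -/
def OnlyPos (i : ℕ) (A : FType) : Prop := A.occ false i = false

/-- All free occurrences of the variable `i` in `A` are negative. -/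
def OnlyNeg (i : ℕ) (A : FType) : Prop := A.occ true i = false

/-- The variable `i` occurs free in `A`. -/
def free (i : ℕ) (A : FType) : Bool := A.occ true i || A.occ false i

/-- The types of the calculus: fixpoints are formed only over positive variables. -/
def WF : FType → Prop
  | var _ => True
  | arr A B => A.WF ∧ B.WF
  | all A => A.WF
  | one => True
  | zero => True
  | prod A B => A.WF ∧ B.WF
  | sum A B => A.WF ∧ B.WF
  | mu A => A.WF ∧ OnlyPos 0 A
  | nu A => A.WF ∧ OnlyPos 0 A

/-- Extension of a renaming under a binder. -/
def upRen (f : ℕ → ℕ) : ℕ → ℕ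
  | 0 => 0
  | i + 1 => f i + 1

def rename : (ℕ → ℕ) → FType → FType
  | f, var i => var (f i)
  | f, arr A B => arr (A.rename f) (B.rename f)
  | f, all A => all (A.rename (upRen f))
  | _, one => one
  | _, zero => zero
  | f, prod A B => prod (A.rename f) (B.rename f)
  | f, sum A B => sum (A.rename f) (B.rename f)
  | f, mu A => mu (A.rename (upRen f))
  | f, nu A => nu (A.rename (upRen f))

/-- `A` read under one additional binder, whose variable does not occur in it. -/
def shift (A : FType) : FType := A.rename Nat.succ

/-- Extension of a substitution under a binder. -/
def upSubst (σ : ℕ → FType) : ℕ → FType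
  | 0 => var 0
  | i + 1 => (σ i).shift

/-- Simultaneous capture-avoiding substitution. -/
def subst : (ℕ → FType) → FType → FType
  | σ, var i => σ i
  | σ, arr A B => arr (A.subst σ) (B.subst σ)
  | σ, all A => all (A.subst (upSubst σ))
  | _, one => one
  | _, zero => zero
  | σ, prod A B => prod (A.subst σ) (B.subst σ)
  | σ, sum A B => sum (A.subst σ) (B.subst σ)
  | σ, mu A => mu (A.subst (upSubst σ))
  | σ, nu A => nu (A.subst (upSubst σ))

/-- `A.inst i C` is `A[C/X]` where `X` is the variable of index `i`, which is removed from the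
context: the variables above `i` move down by one. -/
def inst (A : FType) (i : ℕ) (C : FType) : FType :=
  A.subst fun j => if j < i then var j else if j = i then C else var (j - 1)

/-- The renaming that exchanges the two innermost variables. -/
def swap01 : ℕ → ℕ
  | 0 => 1
  | 1 => 0
  | i + 2 => i + 2

/-- `∀ Y₁ … ∀ Yₘ. A`. -/
def alls : ℕ → FType → FType
  | 0, A => A
  | m + 1, A => all (alls m A)

/-- `A₁ ⇒ … ⇒ Aₖ ⇒ B`. -/
def arrs : List FType → FType → FType
  | [], B => B
  | A :: L, B => arr A (arrs L B)

/-- Finite products; the empty product is `1`. -/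
def prods : List FType → FType
  | [] => one
  | [A] => A
  | A :: B :: L => prod A (prods (B :: L))

/-- Finite sums; the empty sum is `0`. -/
def sums : List FType → FType
  | [] => zero
  | [A] => A
  | A :: B :: L => sum A (sums (B :: L))

/-- `∃ Y₁ … Yₘ. A`, that is `∀ Y'. (∀ Y₁ … ∀ Yₘ. A ⇒ Y') ⇒ Y'`; for the empty list of variables
it is `A`. -/
def exs : ℕ → FType → FType
  | 0, A => A
  | m + 1, A =>
    all (arr
      (alls (m + 1)
        (arr (A.rename fun i => if i < m + 1 then i else i + 1) (var (m + 1))))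
      (var 0))

/-- The renaming that makes the variable of index `y` the innermost one and keeps the order of the
others. -/
def toFront (y : ℕ) (i : ℕ) : ℕ := if i < y then i + 1 else if i = y then 0 else i

/-- `{μ X.} T`, where `X` is the variable of index `y` in `T`: the binder is applied only if `X`
occurs in `T`. In both cases `X` is removed from the context. -/
def muOpt (y : ℕ) (T : FType) : FType :=
  if T.free y then mu (T.rename (toFront y)) else T.inst y one

/-- `{ν X.} T`, where `X` is the variable of index `y` in `T`: the binder is applied only if `X`
occurs in `T`. In both cases `X` is removed from the context. -/
def nuOpt (y : ℕ) (T : FType) : FType :=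
  if T.free y then nu (T.rename (toFront y)) else T.inst y one

end FType

open FType in
/-- The axiomatization of `βη`-isomorphisms. -/
inductive BetaEtaAx : FType → FType → Prop
  | arr_swap (A B C : FType) : BetaEtaAx (arr A (arr B C)) (arr B (arr A C))
  | all_swap (A : FType) : BetaEtaAx (all (all A)) (all (all (A.rename swap01)))
  | all_vacuous (A : FType) : BetaEtaAx A (all A.shift)
  | arr_all (A B : FType) : BetaEtaAx (arr A (all B)) (all (arr A.shift B))
  | prod_one (A : FType) : BetaEtaAx (prod A one) A
  | one_arr (A : FType) : BetaEtaAx (arr one A) A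
  | prod_assoc (A B C : FType) : BetaEtaAx (prod A (prod B C)) (prod (prod A B) C)
  | prod_comm (A B : FType) : BetaEtaAx (prod A B) (prod B A)
  | curry (A B C : FType) : BetaEtaAx (arr (prod A B) C) (arr A (arr B C))
  | all_prod (A B : FType) : BetaEtaAx (all (prod A B)) (prod (all A) (all B))
  | sum_zero (A : FType) : BetaEtaAx (sum A zero) A
  | prod_zero (A : FType) : BetaEtaAx (prod A zero) zero
  | zero_arr (A : FType) : BetaEtaAx (arr zero A) one
  | sum_assoc (A B C : FType) : BetaEtaAx (sum A (sum B C)) (sum (sum A B) C)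
  | sum_comm (A B : FType) : BetaEtaAx (sum A B) (sum B A)
  | prod_sum (A B C : FType) : BetaEtaAx (prod A (sum B C)) (sum (prod A B) (prod A C))
  | sum_arr (A B C : FType) : BetaEtaAx (arr (sum A B) C) (prod (arr A C) (arr B C))
  | mu_vacuous (A : FType) : BetaEtaAx (mu A.shift) A
  | nu_vacuous (A : FType) : BetaEtaAx (nu A.shift) A
  | mu_unfold (A : FType) : BetaEtaAx (mu A) (A.inst 0 (mu A))
  | nu_unfold (A : FType) : BetaEtaAx (nu A) (A.inst 0 (nu A))

open FType in
/-- The two schemas of Yoneda type isomorphisms. Inside `∀ X. ∀ Y₁ … ∀ Y_y` the variable `X` has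
index `y`. The list `H` has one entry for each `k`, whose first component is the number of variables
in the list `Z_k`; inside `∀ Z_k` the variable `X` has index `y + h.1`. -/
inductive YonedaAx : FType → FType → Prop
  /-- `∀X.∀Y. ⟨∀Z_k. ⟨A_jk⟩_j ⇒ X⟩_k ⇒ B  ≡  ∀Y. B[X ↦ {μX.} ∑_k ∃Z_k. ∏_j A_jk]`, where `X` is
  only positive in the `A_jk` and in `B`. -/
  | pos (y : ℕ) (H : List (ℕ × List FType)) (B : FType)
      (hA : ∀ h ∈ H, ∀ A ∈ h.2, OnlyPos (y + h.1) A) (hB : OnlyPos y B) :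
      YonedaAx
        (all (alls y
          (arrs (H.map fun h => alls h.1 (arrs h.2 (var (y + h.1)))) B)))
        (alls y (B.inst y (muOpt y (sums (H.map fun h => exs h.1 (prods h.2))))))
  /-- `∀X.∀Y. ⟨∀Z_k. X ⇒ A_k⟩_k ⇒ B  ≡  ∀Y. B[X ↦ {νX.} ∏_k ∀Z_k. A_k]`, where `X` is only
  positive in the `A_k` (so negative in the whole type) and only negative in `B`. -/
  | neg (y : ℕ) (H : List (ℕ × FType)) (B : FType)
      (hA : ∀ h ∈ H, OnlyPos (y + h.1) h.2) (hB : OnlyNeg y B) :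
      YonedaAx
        (all (alls y
          (arrs (H.map fun h => alls h.1 (arr (var (y + h.1)) h.2)) B)))
        (alls y (B.inst y (nuOpt y (prods (H.map fun h => alls h.1 h.2)))))

open FType in
/-- `A ≡_Y B`: the type `A` can be converted to the type `B` by the Yoneda type isomorphisms and the
axiomatized `βη`-isomorphisms, applied in either direction and in any context. All types involved
are well formed. -/
inductive YonedaEquiv : FType → FType → Prop
  | beta_eta {A B : FType} : BetaEtaAx A B → A.WF → B.WF → YonedaEquiv A B
  | yoneda {A B : FType} : YonedaAx A B → A.WF → B.WF → YonedaEquiv A B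
  | refl {A : FType} : A.WF → YonedaEquiv A A
  | symm {A B : FType} : YonedaEquiv A B → YonedaEquiv B A
  | trans {A B C : FType} : YonedaEquiv A B → YonedaEquiv B C → YonedaEquiv A C
  | arr {A A' B B' : FType} :
      YonedaEquiv A A' → YonedaEquiv B B' → YonedaEquiv (arr A B) (arr A' B')
  | all {A A' : FType} : YonedaEquiv A A' → YonedaEquiv (all A) (all A')
  | prod {A A' B B' : FType} :
      YonedaEquiv A A' → YonedaEquiv B B' → YonedaEquiv (prod A B) (prod A' B')
  | sum {A A' B B' : FType} :
      YonedaEquiv A A' → YonedaEquiv B B' → YonedaEquiv (sum A B) (sum A' B')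
  | mu {A A' : FType} : YonedaEquiv A A' → OnlyPos 0 A → OnlyPos 0 A' →
      YonedaEquiv (mu A) (mu A')
  | nu {A A' : FType} : YonedaEquiv A A' → OnlyPos 0 A → OnlyPos 0 A' →
      YonedaEquiv (nu A) (nu A')

/-! ### Simple types and the simply typed lambda-calculus -/

/-- Simple types over a countable set of type variables. -/
inductive SType : Type
  | var : ℕ → SType
  | arr : SType → SType → SType

/-- Terms of the simply typed lambda-calculus à la Church, with de Bruijn indices. -/
inductive STerm : Type
  | var : ℕ → STerm
  | lam : SType → STerm → STerm
  | app : STerm → STerm → STerm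

/-- The typing judgement `Γ ⊢ t : A`. -/
inductive STerm.HasType : List SType → STerm → SType → Prop
  | var {Γ : List SType} {x : ℕ} {A : SType} : Γ[x]? = some A → HasType Γ (STerm.var x) A
  | lam {Γ : List SType} {A B : SType} {t : STerm} :
      HasType (A :: Γ) t B → HasType Γ (STerm.lam A t) (SType.arr A B)
  | app {Γ : List SType} {A B : SType} {t u : STerm} :
      HasType Γ t (SType.arr A B) → HasType Γ u A → HasType Γ (STerm.app t u) B

namespace SType

/-- Some closed term has type `A`. -/
def IsInhabited (A : SType) : Prop := ∃ t : STerm, STerm.HasType [] t A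

/-- The number of positive (`b = true`) or negative (`b = false`) occurrences of a variable. -/
def count : SType → Bool → ℕ → ℕ
  | var j, b, i => if b = true ∧ i = j then 1 else 0
  | arr A B, b, i => A.count (!b) i + B.count b i

/-- The variable `i` occurs in `A`. -/
def Occurs (i : ℕ) : SType → Prop
  | var j => i = j
  | arr A B => Occurs i A ∨ Occurs i B

/-- Every variable of `A` occurs exactly once positively and exactly once negatively. -/
def Balanced (A : SType) : Prop :=
  ∀ i, Occurs i A → A.count true i = 1 ∧ A.count false i = 1

/-- No variable has two negative occurrences in `A`. -/
def NegNonDup (A : SType) : Prop := ∀ i, A.count false i ≤ 1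

/-- Simple types as types of the larger calculus. -/
def toFType : SType → FType
  | var i => FType.var i
  | arr A B => FType.arr A.toFType B.toFType

end SType

/-! A closed term of type `A` yields a cut-free derivation of `A` (`IsInhabited.prov`, by evaluation
in the Kripke model of contexts), and balanced types are negatively non-duplicated. It remains to
collapse a provable, negatively non-duplicated type, by strong induction on its number of arrows
(`NegNonDup.alls_equiv_one`).

Let x be the head of A. In a cut-free derivation, a goal with head z is solved by a hypothesis with
head z, which is a negative hereditary premise of A. Non-duplication leaves only one candidate, so
the heads of the subgoals are exactly the `Dep`-predecessors of z. As the derivation is finite, x is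
accessible (`Prov.acc_dep`), and `Dep` has no cycle through x. Let K be the set of variables from
which x is reachable along `Dep`, including x. Negative premises with head outside K can be deleted,
both from the derivation (`Prov.del`) and up to isomorphism under the quantifiers
(`NegNonDup.alls_del`). For the latter, each such premise F is replaced by a fresh t with a clause t
⇒ F; these clauses are discarded by Yoneda elimination of their heads, and t is then replaced by 1
instead of F.

In the remaining type, a second positive occurrence of x would close a `Dep` cycle. So x occurs once
positively, and once negatively as the head of a premise ⟨B_j⟩ ⇒ x. The Yoneda isomorphism at x
turns (⟨B_j⟩ ⇒ x) ⇒ Γ ⇒ x into Γ ⇒ ∏ B_j, that is ∏ (Γ ⇒ B_j). Every factor is smaller, negatively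
non-duplicated and provable (`Prov.strengthen`), hence isomorphic to 1 by induction. -/

namespace FType

/-! ### Free occurrences, renaming and substitution. -/

theorem occ_rename (A : FType) (f : ℕ → ℕ) (b : Bool) (i : ℕ) :
    (A.rename f).occ b i = true ↔ ∃ j, A.occ b j = true ∧ f j = i := by
  have binder : ∀ (A : FType) (f : ℕ → ℕ) (b : Bool) (i : ℕ),
      (∃ j, A.occ b j = true ∧ upRen f j = i + 1) ↔ ∃ j, A.occ b (j + 1) = true ∧ f j = i := by
    intro A f b i
    constructor
    · rintro ⟨_ | j, h, e⟩
      · simp [upRen] at e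
      · exact ⟨j, h, by simpa [upRen] using e⟩
    · rintro ⟨j, h, e⟩
      exact ⟨j + 1, h, by simp [upRen, e]⟩
  induction A generalizing f b i with
  | var j => simp [rename, occ]; grind
  | arr A B ihA ihB => simp [rename, occ, ihA, ihB, or_and_right, exists_or]
  | all A ih => simp only [rename, occ, ih, binder]
  | one => simp [rename, occ]
  | zero => simp [rename, occ]
  | prod A B ihA ihB => simp [rename, occ, ihA, ihB, or_and_right, exists_or]
  | sum A B ihA ihB => simp [rename, occ, ihA, ihB, or_and_right, exists_or]
  | mu A ih => simp only [rename, occ, ih, binder]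
  | nu A ih => simp only [rename, occ, ih, binder]

theorem occ_shift_zero (A : FType) (b : Bool) : A.shift.occ b 0 = false := by
  rw [← Bool.not_eq_true, shift, occ_rename]
  rintro ⟨j, -, h⟩
  exact absurd h (Nat.succ_ne_zero j)

theorem occ_shift_succ (A : FType) (b : Bool) (i : ℕ) : A.shift.occ b (i + 1) = A.occ b i := by
  rw [Bool.eq_iff_iff, shift, occ_rename]
  simp

/-- Polarities multiply along substitution; `b == c` is the product of signs, with `true` as the
unit. -/
theorem occ_subst (A : FType) (σ : ℕ → FType) (b : Bool) (i : ℕ) :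
    (A.subst σ).occ b i = true ↔
      ∃ j c, A.occ c j = true ∧ (σ j).occ (b == c) i = true := by
  have binder : ∀ (A : FType) (σ : ℕ → FType) (b : Bool) (i : ℕ),
      (∃ j c, A.occ c j = true ∧ (upSubst σ j).occ (b == c) (i + 1) = true) ↔
        ∃ j c, A.occ c (j + 1) = true ∧ (σ j).occ (b == c) i = true := by
    intro A σ b i
    constructor
    · rintro ⟨_ | j, c, h, e⟩
      · simp [upSubst, occ] at e
      · exact ⟨j, c, h, by simpa [upSubst, occ_shift_succ] using e⟩
    · rintro ⟨j, c, h, e⟩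
      exact ⟨j + 1, c, h, by simpa [upSubst, occ_shift_succ] using e⟩
  induction A generalizing σ b i with
  | var j => cases b <;> simp [subst, occ]
  | arr A B ihA ihB =>
    simp only [subst, occ, Bool.or_eq_true, ihA, ihB]
    constructor
    · rintro (⟨j, c, h, e⟩ | ⟨j, c, h, e⟩)
      · exact ⟨j, !c, Or.inl (by simpa using h), by cases b <;> cases c <;> exact e⟩
      · exact ⟨j, c, Or.inr h, e⟩
    · rintro ⟨j, c, h | h, e⟩
      · exact Or.inl ⟨j, !c, h, by cases b <;> cases c <;> exact e⟩
      · exact Or.inr ⟨j, c, h, e⟩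
  | all A ih => simp only [subst, occ, ih, binder]
  | one => simp [subst, occ]
  | zero => simp [subst, occ]
  | prod A B ihA ihB => simp [subst, occ, ihA, ihB, or_and_right, exists_or]
  | sum A B ihA ihB => simp [subst, occ, ihA, ihB, or_and_right, exists_or]
  | mu A ih => simp only [subst, occ, ih, binder]
  | nu A ih => simp only [subst, occ, ih, binder]

theorem subst_congr (A : FType) {σ τ : ℕ → FType}
    (h : ∀ j b, A.occ b j = true → σ j = τ j) : A.subst σ = A.subst τ := by
  have binder : ∀ (A : FType) {σ τ : ℕ → FType},
      (∀ j b, A.occ b (j + 1) = true → σ j = τ j) →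
        ∀ j b, A.occ b j = true → upSubst σ j = upSubst τ j := by
    rintro A σ τ h (_ | j) b hj
    · rfl
    · simp [upSubst, h j b hj]
  induction A generalizing σ τ with
  | var j => exact h j true (by simp [occ])
  | arr A B ihA ihB =>
    simp only [occ, Bool.or_eq_true] at h
    rw [subst, subst, ihA fun j b hj => h j (!b) (Or.inl (by simpa using hj)),
      ihB fun j b hj => h j b (Or.inr hj)]
  | all A ih => rw [subst, subst, ih (binder A h)]
  | one => rfl
  | zero => rfl
  | prod A B ihA ihB =>
    simp only [occ, Bool.or_eq_true] at h
    rw [subst, subst, ihA fun j b hj => h j b (Or.inl hj), ihB fun j b hj => h j b (Or.inr hj)]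
  | sum A B ihA ihB =>
    simp only [occ, Bool.or_eq_true] at h
    rw [subst, subst, ihA fun j b hj => h j b (Or.inl hj), ihB fun j b hj => h j b (Or.inr hj)]
  | mu A ih => rw [subst, subst, ih (binder A h)]
  | nu A ih => rw [subst, subst, ih (binder A h)]

theorem upSubst_var : upSubst var = var := by
  funext j
  cases j <;> rfl

theorem subst_var (A : FType) : A.subst var = A := by
  induction A <;> simp_all [subst, upSubst_var]

theorem upRen_comp (f g : ℕ → ℕ) : upRen (g ∘ f) = upRen g ∘ upRen f := by
  funext j
  cases j <;> rfl

theorem rename_rename (A : FType) (f g : ℕ → ℕ) :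
    (A.rename f).rename g = A.rename (g ∘ f) := by
  induction A generalizing f g <;> simp_all [rename, upRen_comp]

theorem rename_shift (A : FType) (f : ℕ → ℕ) :
    A.shift.rename (upRen f) = (A.rename f).shift := by
  simp only [shift, rename_rename]
  rfl

theorem rename_subst (A : FType) (σ : ℕ → FType) (f : ℕ → ℕ) :
    (A.subst σ).rename f = A.subst fun j => (σ j).rename f := by
  have binder : ∀ (σ : ℕ → FType) (f : ℕ → ℕ),
      (upSubst fun j => (σ j).rename f) = fun j => (upSubst σ j).rename (upRen f) := by
    intro σ f
    funext j
    cases j with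
    | zero => rfl
    | succ j => simp [upSubst, rename_shift]
  induction A generalizing σ f <;> simp_all [rename, subst]

theorem WF_rename {A : FType} (h : A.WF) (f : ℕ → ℕ) : (A.rename f).WF := by
  have binder : ∀ (A : FType) (f : ℕ → ℕ), OnlyPos 0 A → OnlyPos 0 (A.rename (upRen f)) := by
    intro A f h
    rw [OnlyPos, ← Bool.not_eq_true, occ_rename]
    rintro ⟨_ | j, hj, e⟩
    · simp [OnlyPos, hj] at h
    · simp [upRen] at e
  induction A generalizing f with
  | mu A ih => exact ⟨ih h.1 _, binder A f h.2⟩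
  | nu A ih => exact ⟨ih h.1 _, binder A f h.2⟩
  | _ => simp_all [rename, WF]

theorem WF_subst {A : FType} (h : A.WF) {σ : ℕ → FType} (hσ : ∀ j, (σ j).WF) :
    (A.subst σ).WF := by
  have binder : ∀ (A : FType) (σ : ℕ → FType),
      OnlyPos 0 A → OnlyPos 0 (A.subst (upSubst σ)) := by
    intro A σ h
    rw [OnlyPos, ← Bool.not_eq_true, occ_subst]
    rintro ⟨_ | j, c, hj, e⟩
    · cases c
      · simp [OnlyPos, hj] at h
      · simp [upSubst, occ] at e
    · simp [upSubst, occ_shift_zero] at e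
  have up : ∀ {σ : ℕ → FType}, (∀ j, (σ j).WF) → ∀ j, (upSubst σ j).WF := by
    rintro σ hσ (_ | j)
    · trivial
    · exact WF_rename (hσ j) _
  induction A generalizing σ with
  | var j => exact hσ j
  | arr A B ihA ihB => exact ⟨ihA h.1 hσ, ihB h.2 hσ⟩
  | all A ih => exact ih h (up hσ)
  | one => trivial
  | zero => trivial
  | prod A B ihA ihB => exact ⟨ihA h.1 hσ, ihB h.2 hσ⟩
  | sum A B ihA ihB => exact ⟨ihA h.1 hσ, ihB h.2 hσ⟩
  | mu A ih => exact ⟨ih h.1 (up hσ), binder A σ h.2⟩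
  | nu A ih => exact ⟨ih h.1 (up hσ), binder A σ h.2⟩

theorem free_eq_true {A : FType} {i : ℕ} : A.free i = true ↔ ∃ b, A.occ b i = true := by
  simp [free, or_comm]

theorem free_eq_false {A : FType} {i : ℕ} : A.free i = false ↔ ∀ b, A.occ b i = false := by
  simp [free, and_comm]

/-! ### Substitution for one variable that keeps the others in place -/

/-- `A[T/X]`, where the other variables keep their indices. -/
def repl (i : ℕ) (T A : FType) : FType := A.subst (Function.update var i T)

theorem repl_var_self (i : ℕ) (T : FType) : repl i T (var i) = T := by
  simp [repl, subst]

theorem repl_eq_self {A : FType} {i : ℕ} (h : A.free i = false) (T : FType) :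
    repl i T A = A := by
  conv_rhs => rw [← subst_var A]
  refine subst_congr A fun j b hj => Function.update_of_ne ?_ _ _
  rintro rfl
  simp [free_eq_false.1 h] at hj

theorem WF_repl {A T : FType} (hA : A.WF) (hT : T.WF) (i : ℕ) : (repl i T A).WF := by
  refine WF_subst hA fun j => ?_
  by_cases h : j = i
  · subst h; simpa using hT
  · simp [Function.update_of_ne h, WF]

theorem occ_repl {A T : FType} {i : ℕ} {b : Bool} {j : ℕ} (h : (repl i T A).occ b j = true) :
    (A.occ b j = true ∧ j ≠ i) ∨ ∃ c, A.occ c i = true ∧ T.occ (b == c) j = true := by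
  obtain ⟨k, c, hk, e⟩ := (occ_subst _ _ _ _).1 h
  by_cases hki : k = i
  · subst hki
    exact Or.inr ⟨c, hk, by simpa using e⟩
  · rw [Function.update_of_ne hki] at e
    simp only [occ, Bool.and_eq_true, beq_iff_eq, decide_eq_true_eq] at e
    obtain ⟨rfl, rfl⟩ := e
    exact Or.inl ⟨hk, hki⟩

/-- The renaming that makes room for a variable of index `i`. -/
def skip (i j : ℕ) : ℕ := if j < i then j else j + 1

theorem upRen_skip (i : ℕ) : upRen (skip i) = skip (i + 1) := by
  funext j
  cases j with
  | zero => simp [upRen, skip]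
  | succ j => simp only [upRen, skip]; split_ifs <;> omega

/-- The Yoneda schemas remove X from the context and so move the other indices. Putting a dummy
variable back in the same place turns `inst` into a substitution that leaves all other indices
alone. -/
theorem rename_skip_inst (A : FType) (i : ℕ) (T : FType) :
    (A.inst i T).rename (skip i) = repl i (T.rename (skip i)) A := by
  rw [inst, rename_subst, repl]
  congr 1
  funext j
  rcases lt_trichotomy j i with h | h | h
  · simp [h, rename, skip, Function.update_of_ne h.ne]
  · simp [h]
  · simp [h.not_gt, h.ne', rename, skip]
    split_ifs <;> omega

theorem alls_add (a b : ℕ) (A : FType) : alls (a + b) A = alls a (alls b A) := by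
  induction a with
  | zero => simp [alls]
  | succ a ih => rw [Nat.succ_add, alls, alls, ih]

theorem rename_skip_alls (n i : ℕ) (A : FType) :
    (alls n A).rename (skip i) = alls n (A.rename (skip (i + n))) := by
  induction n generalizing i with
  | zero => rfl
  | succ n ih => rw [alls, rename, upRen_skip, ih, alls, Nat.add_right_comm, Nat.add_assoc]

theorem shift_alls (n : ℕ) (A : FType) : (alls n A).shift = alls n (A.rename (skip n)) := by
  have h : Nat.succ = skip 0 := by funext j; simp [skip]
  rw [shift, h, rename_skip_alls, Nat.zero_add]

theorem WF_alls {n : ℕ} {A : FType} : (alls n A).WF ↔ A.WF := by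
  induction n with
  | zero => rfl
  | succ n ih => exact ih

theorem WF_arrs {L : List FType} {B : FType} : (arrs L B).WF ↔ (∀ A ∈ L, A.WF) ∧ B.WF := by
  induction L with
  | nil => simp [arrs]
  | cons A L ih => simp [arrs, WF, ih, and_assoc]

theorem WF_prods {L : List FType} (h : ∀ A ∈ L, A.WF) : (prods L).WF := by
  induction L using prods.induct <;> simp_all [prods, WF]

theorem WF_sums {L : List FType} (h : ∀ A ∈ L, A.WF) : (sums L).WF := by
  induction L using sums.induct <;> simp_all [sums, WF]

theorem occ_prods {L : List FType} {b : Bool} {i : ℕ} (h : (prods L).occ b i = true) :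
    ∃ A ∈ L, A.occ b i = true := by
  induction L using prods.induct <;> simp_all [prods, occ]
  grind

theorem occ_sums {L : List FType} {b : Bool} {i : ℕ} (h : (sums L).occ b i = true) :
    ∃ A ∈ L, A.occ b i = true := by
  induction L using sums.induct <;> simp_all [sums, occ]
  grind

theorem occ_arrs {L : List FType} {B : FType} {b : Bool} {i : ℕ} :
    (arrs L B).occ b i = true ↔ (∃ A ∈ L, A.occ (!b) i = true) ∨ B.occ b i = true := by
  induction L with
  | nil => simp [arrs]
  | cons A L ih => simp [arrs, occ, ih, or_assoc]

theorem repl_arrs (i : ℕ) (T : FType) (L : List FType) (B : FType) :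
    repl i T (arrs L B) = arrs (L.map (repl i T)) (repl i T B) := by
  induction L with
  | nil => rfl
  | cons A L ih => exact congrArg (arr (repl i T A)) ih

theorem repl_var_of_ne {i j : ℕ} (h : j ≠ i) (T : FType) : repl i T (var j) = var j := by
  simp [repl, subst, Function.update_of_ne h]

end FType

/-! ### Derived isomorphisms and elimination of quantified variables. -/

namespace YonedaEquiv

open FType

theorem wf {A B : FType} (h : YonedaEquiv A B) : A.WF ∧ B.WF := by
  induction h <;> simp_all [WF]

theorem alls {A B : FType} (h : YonedaEquiv A B) (n : ℕ) :
    YonedaEquiv (alls n A) (alls n B) := by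
  induction n with
  | zero => exact h
  | succ n ih => exact ih.all

theorem arr_comm {A B C : FType} (hA : A.WF) (hB : B.WF) (hC : C.WF) :
    YonedaEquiv (FType.arr A (FType.arr B C)) (FType.arr B (FType.arr A C)) :=
  .beta_eta (.arr_swap _ _ _) ⟨hA, hB, hC⟩ ⟨hB, hA, hC⟩

theorem arr_all {A B : FType} (hA : A.WF) (hB : B.WF) :
    YonedaEquiv (FType.arr A (FType.all B)) (FType.all (FType.arr A.shift B)) :=
  .beta_eta (.arr_all _ _) ⟨hA, hB⟩ ⟨WF_rename hA _, hB⟩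

theorem sum_arr {A B C : FType} (hA : A.WF) (hB : B.WF) (hC : C.WF) :
    YonedaEquiv (FType.arr (FType.sum A B) C) (FType.prod (FType.arr A C) (FType.arr B C)) :=
  .beta_eta (.sum_arr _ _ _) ⟨⟨hA, hB⟩, hC⟩ ⟨⟨hA, hC⟩, hB, hC⟩

theorem all_prod {A B : FType} (hA : A.WF) (hB : B.WF) :
    YonedaEquiv (FType.all (FType.prod A B)) (FType.prod (FType.all A) (FType.all B)) :=
  .beta_eta (.all_prod _ _) ⟨hA, hB⟩ ⟨hA, hB⟩

theorem arrs_perm {L L' : List FType} (hp : L.Perm L') (hL : ∀ A ∈ L, A.WF) {B : FType}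
    (hB : B.WF) : YonedaEquiv (arrs L B) (arrs L' B) := by
  induction hp with
  | nil => exact .refl hB
  | cons A _ ih =>
    rw [List.forall_mem_cons] at hL
    exact .arr (.refl hL.1) (ih hL.2)
  | swap A A' L =>
    simp only [List.forall_mem_cons] at hL
    have := (WF_arrs (L := L) (B := B)).2 ⟨hL.2.2, hB⟩
    exact arr_comm hL.1 hL.2.1 this
  | trans h₁ _ ih₁ ih₂ =>
    exact (ih₁ hL).trans (ih₂ fun A hA => hL A (h₁.mem_iff.2 hA))

/-- Write 1 as 0 ⇒ 0 and exchange the two premises: the type then has the form 0 ⇒ C. -/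
theorem arr_one {A : FType} (hA : A.WF) : YonedaEquiv (FType.arr A one) one := by
  have h : YonedaEquiv (FType.arr zero zero) one :=
    .beta_eta (.zero_arr _) ⟨trivial, trivial⟩ trivial
  exact ((arr (refl hA) h).symm.trans (arr_comm hA trivial trivial)).trans
    (.beta_eta (.zero_arr _) ⟨trivial, hA, trivial⟩ trivial)

theorem arrs_one {L : List FType} (hL : ∀ A ∈ L, A.WF) : YonedaEquiv (arrs L one) one := by
  induction L with
  | nil => exact .refl trivial
  | cons A L ih =>
    rw [List.forall_mem_cons] at hL
    exact (arr (refl hL.1) (ih hL.2)).trans (arr_one hL.1)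

theorem alls_one (n : ℕ) : YonedaEquiv (FType.alls n one) one := by
  induction n with
  | zero => exact .refl trivial
  | succ n ih => exact ih.all.trans (symm (.beta_eta (.all_vacuous one) trivial trivial))

theorem alls_prod (n : ℕ) {A B : FType} (hA : A.WF) (hB : B.WF) :
    YonedaEquiv (FType.alls n (FType.prod A B)) (FType.prod (FType.alls n A) (FType.alls n B)) := by
  induction n with
  | zero => exact .refl ⟨hA, hB⟩
  | succ n ih =>
    exact ih.all.trans (all_prod ih.wf.2.1 ih.wf.2.2)

/-- The eliminated quantifier is reinstated as a vacuous one, so the block of n quantifiers keeps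
its length and indices through repeated eliminations. -/
theorem alls_repl {i n : ℕ} (hi : i < n) {A B T : FType}
    (h : YonedaEquiv (FType.all (FType.alls i A)) (FType.alls i (B.inst i T))) :
    YonedaEquiv (FType.alls n A) (FType.alls n (repl i (T.rename (skip i)) B)) := by
  obtain ⟨m, rfl⟩ : ∃ m, n = m + (i + 1) := ⟨n - (i + 1), by omega⟩
  rw [Nat.add_comm i, ← Nat.add_assoc, Nat.add_assoc, alls_add, alls_add, alls_add, alls_add]
  refine alls (h.trans ?_) m
  have hw := h.wf.2
  have := BetaEtaAx.all_vacuous (FType.alls i (B.inst i T))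
  rw [shift_alls, rename_skip_inst] at this
  refine .beta_eta this hw ?_
  rw [← rename_skip_inst]
  exact (WF_alls (n := i + 1)).2 (WF_rename (WF_alls.1 hw) _)

theorem rename_skip_inst_of_not_free {A : FType} {i : ℕ} (h : A.free i = false) (T : FType) :
    (A.inst i T).rename (skip i) = A := by
  rw [rename_skip_inst, repl_eq_self h]

theorem occ_rename_toFront {A : FType} {i : ℕ} {b : Bool} {j : ℕ}
    (h : ((FType.mu (A.rename (toFront i))).rename (skip i)).occ b j = true) :
    A.occ b j = true ∧ j ≠ i := by
  obtain ⟨k, hk, rfl⟩ := (occ_rename _ _ _ _).1 h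
  obtain ⟨l, hl, e⟩ := (occ_rename _ _ _ _).1 hk
  have : skip i k = l ∧ skip i k ≠ i := by
    simp only [toFront] at e
    simp only [skip]
    split_ifs at e ⊢ <;> omega
  exact ⟨this.1 ▸ hl, this.2⟩

theorem WF_muOpt {A : FType} {i : ℕ} (hA : A.WF) (hi : OnlyPos i A) : (muOpt i A).WF := by
  rw [muOpt]
  split_ifs with h
  · refine ⟨WF_rename hA _, ?_⟩
    rw [OnlyPos, ← Bool.not_eq_true, occ_rename]
    rintro ⟨j, hj, e⟩
    have : j = i := by
      simp only [toFront] at e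
      split_ifs at e <;> omega
    subst this
    simp [OnlyPos, hj] at hi
  · refine WF_subst hA fun j => ?_
    split_ifs <;> trivial

/-- Elimination of a variable `X` occurring at the head of some hypotheses and otherwise only
positively; the variable stays quantified, vacuously. -/
theorem elim_pos {i n : ℕ} (hi : i < n) (H : List (List FType)) {B : FType}
    (hH : ∀ h ∈ H, ∀ A ∈ h, A.WF ∧ OnlyPos i A) (hB : B.WF) (hBi : OnlyPos i B) :
    ∃ T : FType, T.WF ∧
      (∀ b j, T.occ b j = true → j ≠ i ∧ ∃ h ∈ H, ∃ A ∈ h, A.occ b j = true) ∧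
      ((∀ h ∈ H, ∀ A ∈ h, A.free i = false) → T = sums (H.map prods)) ∧
      YonedaEquiv (FType.alls n (arrs (H.map fun h => arrs h (var i)) B))
        (FType.alls n (repl i T B)) := by
  have hS : ∀ b j, (sums (H.map prods)).occ b j = true → ∃ h ∈ H, ∃ A ∈ h, A.occ b j = true := by
    intro b j hj
    obtain ⟨P, hP, hj⟩ := occ_sums hj
    obtain ⟨h, hh, rfl⟩ := List.mem_map.1 hP
    exact ⟨h, hh, occ_prods hj⟩
  have hSi : OnlyPos i (sums (H.map prods)) := by
    rw [OnlyPos, ← Bool.not_eq_true]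
    intro h
    obtain ⟨h, hh, A, hA, h'⟩ := hS _ _ h
    exact absurd ((hH h hh A hA).2.symm.trans h') (by decide)
  have hSw : (sums (H.map prods)).WF := by
    refine WF_sums fun P hP => ?_
    obtain ⟨h, hh, rfl⟩ := List.mem_map.1 hP
    exact WF_prods fun A hA => (hH h hh A hA).1
  have hTw := WF_muOpt hSw hSi
  refine ⟨(muOpt i (sums (H.map prods))).rename (skip i), WF_rename hTw _, ?_, ?_, ?_⟩
  · intro b j hj
    by_cases hf : (sums (H.map prods)).free i = true
    · rw [muOpt, if_pos hf] at hj
      obtain ⟨h₁, h₂⟩ := occ_rename_toFront hj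
      exact ⟨h₂, hS b j h₁⟩
    · rw [muOpt, if_neg hf, rename_skip_inst_of_not_free (by simpa using hf)] at hj
      refine ⟨?_, hS b j hj⟩
      rintro rfl
      exact hf (free_eq_true.2 ⟨b, hj⟩)
  · intro hfree
    have hf : (sums (H.map prods)).free i = false := by
      rw [free_eq_false]
      intro b
      rw [← Bool.not_eq_true]
      intro h
      obtain ⟨h, hh, A, hA, h'⟩ := hS _ _ h
      simp [free_eq_false.1 (hfree h hh A hA)] at h'
    rw [muOpt, if_neg (by simp [hf]), rename_skip_inst_of_not_free hf]
  · refine alls_repl hi (.yoneda ?_ ?_ ?_)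
    · have := YonedaAx.pos i (H.map fun h => (0, h)) B ?_ hBi
      · simpa only [List.map_map, Function.comp_def, FType.alls, Nat.add_zero, exs] using this
      · intro h hh A hA
        obtain ⟨h', hh', rfl⟩ := List.mem_map.1 hh
        exact (hH h' hh' A hA).2
    · refine WF_alls.2 (WF_arrs.2 ⟨?_, hB⟩)
      intro A hA
      obtain ⟨h, hh, rfl⟩ := List.mem_map.1 hA
      exact WF_arrs.2 ⟨fun A hA => (hH h hh A hA).1, trivial⟩
    · refine WF_alls.2 (WF_subst hB fun j => ?_)
      split_ifs
      · trivial
      · exact hTw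
      · trivial

/-- Elimination of a variable `X` occurring in a hypothesis `X ⇒ F` and otherwise only
negatively; the variable stays quantified, vacuously. -/
theorem elim_neg {i n : ℕ} (hi : i < n) {F B : FType} (hF : F.WF) (hFi : F.free i = false)
    (hB : B.WF) (hBi : OnlyNeg i B) :
    YonedaEquiv (FType.alls n (FType.arr (FType.arr (var i) F) B))
      (FType.alls n (repl i F B)) := by
  have hT : nuOpt i F = F.inst i one := by simp [nuOpt, hFi]
  have h : YonedaEquiv (FType.all (FType.alls i (FType.arr (FType.arr (var i) F) B)))
      (FType.alls i (B.inst i (F.inst i one))) := by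
    refine .yoneda ?_ ?_ ?_
    · have := YonedaAx.neg i [(0, F)] B ?_ hBi
      · simpa [FType.alls, prods, arrs, hT] using this
      · simpa [OnlyPos] using free_eq_false.1 hFi false
    · exact WF_alls.2 ⟨⟨trivial, hF⟩, hB⟩
    · refine WF_alls.2 (WF_subst hB fun j => ?_)
      split_ifs
      · trivial
      · refine WF_subst hF fun j => ?_
        split_ifs <;> trivial
      · trivial
  have := alls_repl hi h
  rwa [rename_skip_inst_of_not_free hFi] at this

/-- The positive Yoneda schema with one hypothesis and body X. -/
theorem all_arr_self {A : FType} (hA : A.WF) :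
    YonedaEquiv (FType.all (FType.arr (FType.arr A.shift (var 0)) (var 0))) A := by
  have hw : A.shift.WF := WF_rename hA _
  have hf : A.shift.free 0 = false := free_eq_false.2 (occ_shift_zero A)
  have hinst : A.shift.inst 0 one = A := by
    have h := rename_skip_inst_of_not_free hf one
    have hs : skip 0 = Nat.succ := by funext j; simp [skip]
    rw [hs] at h
    have hi : ∀ {A B : FType}, A.shift = B.shift → A = B := by
      intro A B h
      have hl : ∀ A : FType, A.shift.rename Nat.pred = A := by
        intro A
        have hr : ∀ A : FType, A.rename id = A := by
          intro A
          have hu : upRen id = id := by funext j; cases j <;> rfl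
          induction A <;> simp_all [rename]
        rw [shift, rename_rename]
        exact hr A
      rw [← hl A, h, hl]
    exact hi h
  refine .yoneda ?_ ⟨⟨hw, trivial⟩, trivial⟩ hA
  have := YonedaAx.pos 0 [(0, [A.shift])] (var 0) ?_ (by simp [OnlyPos, occ])
  · have e : (var 0).inst 0 A = A := by simp [inst, subst]
    simpa [FType.alls, arrs, exs, sums, prods, muOpt, hf, hinst, e] using this
  · simpa [OnlyPos] using occ_shift_zero A false

/-- Implication distributes over products in its codomain. -/
theorem arr_prod {A B C : FType} (hA : A.WF) (hB : B.WF) (hC : C.WF) :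
    YonedaEquiv (FType.arr A (FType.prod B C)) (FType.prod (FType.arr A B) (FType.arr A C)) := by
  have hsA : A.shift.WF := WF_rename hA _
  have hsB : B.shift.WF := WF_rename hB _
  have hsC : C.shift.WF := WF_rename hC _
  have aux : ∀ {D : FType}, D.WF → YonedaEquiv
      (FType.all (FType.arr (FType.arr D.shift (var 0)) (FType.arr A.shift (var 0))))
      (FType.arr A D) := by
    intro D hD
    have hsD : D.shift.WF := WF_rename hD _
    have h₁ : YonedaEquiv _ _ := arr_comm (A := FType.arr D.shift (var 0)) (C := var 0)
      ⟨hsD, trivial⟩ hsA trivial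
    have h₂ : YonedaEquiv _ _ := arr_all (B := FType.arr (FType.arr D.shift (var 0)) (var 0))
      hA ⟨⟨hsD, trivial⟩, trivial⟩
    exact (h₁.all.trans h₂.symm).trans (arr (.refl hA) (all_arr_self hD))
  have split : ∀ {E : FType}, E.WF → YonedaEquiv
      (FType.all (FType.arr (FType.sum (FType.arr B.shift (var 0)) (FType.arr C.shift (var 0))) E))
      (FType.prod (FType.all (FType.arr (FType.arr B.shift (var 0)) E))
        (FType.all (FType.arr (FType.arr C.shift (var 0)) E))) := by
    intro E hE
    have h₁ : (FType.arr B.shift (var 0)).WF := ⟨hsB, trivial⟩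
    have h₂ : (FType.arr C.shift (var 0)).WF := ⟨hsC, trivial⟩
    exact (sum_arr h₁ h₂ hE).all.trans (all_prod ⟨h₁, hE⟩ ⟨h₂, hE⟩)
  -- `h₁` presents B × C as ∀Y. ((B ⇒ Y) + (C ⇒ Y)) ⇒ Y, and `h₂` splits the same type with the
  -- extra premise A. Moving A under the quantifier and exchanging premises connects the two.
  have h₁ := (split (E := var 0) trivial).trans (prod (all_arr_self hB) (all_arr_self hC))
  have h₂ := (split (E := FType.arr A.shift (var 0)) ⟨hsA, trivial⟩).trans (prod (aux hB) (aux hC))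
  refine (arr (.refl hA) h₁.symm).trans (.trans ?_ h₂)
  have h₃ : YonedaEquiv _ _ := arr_all (B := FType.arr _ (var 0)) hA h₁.wf.1
  exact h₃.trans (arr_comm (C := var 0) hsA h₁.wf.1.1 trivial).all

theorem arrs_prod {L : List FType} (hL : ∀ A ∈ L, A.WF) {B C : FType} (hB : B.WF) (hC : C.WF) :
    YonedaEquiv (arrs L (FType.prod B C)) (FType.prod (arrs L B) (arrs L C)) := by
  induction L with
  | nil => exact .refl ⟨hB, hC⟩
  | cons A L ih =>
    rw [List.forall_mem_cons] at hL
    exact (arr (.refl hL.1) (ih hL.2)).trans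
      (arr_prod hL.1 (WF_arrs.2 ⟨hL.2, hB⟩) (WF_arrs.2 ⟨hL.2, hC⟩))

theorem alls_arrs_prods_eq_one (n : ℕ) {L : List FType} (hL : ∀ A ∈ L, A.WF) {M : List FType}
    (h : ∀ B ∈ M, YonedaEquiv (FType.alls n (arrs L B)) one) :
    YonedaEquiv (FType.alls n (arrs L (prods M))) one := by
  have hw : ∀ {B : FType}, YonedaEquiv (FType.alls n (arrs L B)) one → B.WF :=
    fun h => (WF_arrs.1 (WF_alls.1 h.wf.1)).2
  induction M using prods.induct with
  | case1 => exact ((arrs_one hL).alls n).trans (alls_one n)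
  | case2 B => exact h B (by simp)
  | case3 B C M ih =>
    rw [List.forall_mem_cons] at h
    have hB := hw h.1
    have hM := ih h.2
    refine ((arrs_prod hL hB (hw hM)).alls n).trans ?_
    refine (alls_prod n (WF_arrs.2 ⟨hL, hB⟩) (WF_arrs.2 ⟨hL, hw hM⟩)).trans ?_
    exact (prod h.1 hM).trans (.beta_eta (.prod_one one) ⟨trivial, trivial⟩ trivial)

/-- Hypotheses whose heads are variables occurring neither in `A` nor negatively in the
premises of the hypotheses may be removed. -/
theorem alls_arrs_remove (n : ℕ) (U : List ℕ) (hU : ∀ u ∈ U, u < n) {A : FType} (hA : A.WF)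
    (hAU : ∀ u ∈ U, A.free u = false) (H : List (List FType × ℕ)) (hH : ∀ h ∈ H, h.2 ∈ U)
    (hP : ∀ h ∈ H, ∀ C ∈ h.1, C.WF ∧ ∀ u ∈ U, OnlyPos u C) :
    YonedaEquiv (FType.alls n (arrs (H.map fun h => arrs h.1 (var h.2)) A)) (FType.alls n A) := by
  induction U generalizing H with
  | nil =>
    have : H = [] := List.eq_nil_iff_forall_not_mem.2 fun h hh => by simpa using hH h hh
    subst this
    exact .refl (WF_alls.2 hA)
  | cons u U ih =>
    set H₁ := H.filter fun h => h.2 = u with hH₁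
    set H₂ := H.filter fun h => ¬ h.2 = u with hH₂
    have hm₁ : ∀ h ∈ H₁, h ∈ H ∧ h.2 = u := fun h hh => by simpa [hH₁] using hh
    have hm₂ : ∀ h ∈ H₂, h ∈ H ∧ h.2 ≠ u := fun h hh => by simpa [hH₂] using hh
    have hperm : H.Perm (H₁ ++ H₂) := by
      have := List.filter_append_perm (fun h : List FType × ℕ => decide (h.2 = u)) H
      simpa [hH₁, hH₂] using this.symm
    have hw : ∀ F ∈ H.map fun h => arrs h.1 (var h.2), F.WF := by
      intro F hF
      obtain ⟨h, hh, rfl⟩ := List.mem_map.1 hF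
      exact WF_arrs.2 ⟨fun C hC => (hP h hh C hC).1, trivial⟩
    refine ((arrs_perm (hperm.map _) hw hA).alls n).trans ?_
    have e₁ : H₁.map (fun h => arrs h.1 (var h.2)) =
        (H₁.map Prod.fst).map fun h => arrs h (var u) := by
      rw [List.map_map]
      exact List.map_congr_left fun h hh => by simp [(hm₁ h hh).2]
    have happ : ∀ (L M : List FType) (B : FType), arrs (L ++ M) B = arrs L (arrs M B) := by
      intro L M B
      induction L with
      | nil => rfl
      | cons C L ih => exact congrArg (FType.arr C) ih
    rw [List.map_append, happ, e₁]
    have hBi : OnlyPos u (arrs (H₂.map fun h => arrs h.1 (var h.2)) A) := by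
      rw [OnlyPos, ← Bool.not_eq_true, occ_arrs]
      rintro (⟨F, hF, h⟩ | h)
      · obtain ⟨h', hh, rfl⟩ := List.mem_map.1 hF
        rw [occ_arrs] at h
        rcases h with ⟨C, hC, h⟩ | h
        · have := (hP h' (hm₂ h' hh).1 C hC).2 u (by simp)
          simp [OnlyPos] at this h
          simp [this] at h
        · simp [occ] at h
          exact (hm₂ h' hh).2 h.symm
      · simp [free_eq_false.1 (hAU u (by simp))] at h
    -- `T` can be a genuine μ-type, since `u` may occur positively in the premises of its own
    -- hypotheses. As `u` is not free in `A`, `T` enters only the premises of the hypotheses in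
    -- `H₂`.
    obtain ⟨T, hT, hTo, -, he⟩ := elim_pos (hU u (by simp)) (H₁.map Prod.fst)
      (B := arrs (H₂.map fun h => arrs h.1 (var h.2)) A)
      (by
        intro h hh C hC
        obtain ⟨h', hh', rfl⟩ := List.mem_map.1 hh
        have := hP h' (hm₁ h' hh').1 C hC
        exact ⟨this.1, this.2 u (by simp)⟩)
      (WF_arrs.2 ⟨fun F hF => hw F (by
        obtain ⟨h, hh, rfl⟩ := List.mem_map.1 hF
        exact List.mem_map.2 ⟨h, (hm₂ h hh).1, rfl⟩), hA⟩) hBi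
    refine he.trans ?_
    -- Substituting for a positive variable a type that is positive in the remaining variables
    -- preserves the invariant `hP`.
    have hTU : ∀ v ∈ U, OnlyPos v T := by
      intro v hv
      rw [OnlyPos, ← Bool.not_eq_true]
      intro h
      obtain ⟨-, L, hL, C, hC, h⟩ := hTo _ _ h
      obtain ⟨h', hh, rfl⟩ := List.mem_map.1 hL
      have := (hP h' (hm₁ h' hh).1 C hC).2 v (by simp [hv])
      simp [OnlyPos, h] at this
    rw [repl_arrs, repl_eq_self (hAU u (by simp))]
    have e₂ : (H₂.map fun h => arrs h.1 (var h.2)).map (repl u T) =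
        (H₂.map fun h => (h.1.map (repl u T), h.2)).map fun h => arrs h.1 (var h.2) := by
      simp only [List.map_map]
      refine List.map_congr_left fun h hh => ?_
      simp [repl_arrs, repl_var_of_ne (hm₂ h hh).2]
    rw [e₂]
    refine ih (fun v hv => hU v (by simp [hv])) (fun v hv => hAU v (by simp [hv])) _ ?_ ?_
    · intro h hh
      obtain ⟨h', hh', rfl⟩ := List.mem_map.1 hh
      have := hH h' (hm₂ h' hh').1
      simpa [(hm₂ h' hh').2] using this
    · intro h hh C hC
      obtain ⟨h', hh', rfl⟩ := List.mem_map.1 hh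
      obtain ⟨C, hC', rfl⟩ := List.mem_map.1 hC
      have hCP := hP h' (hm₂ h' hh').1 C hC'
      refine ⟨WF_repl hCP.1 hT u, fun v hv => ?_⟩
      rw [OnlyPos, ← Bool.not_eq_true]
      intro ho
      rcases occ_repl ho with ⟨ho, -⟩ | ⟨c, hc, ho⟩
      · have := hCP.2 v (by simp [hv])
        simp [OnlyPos, ho] at this
      · cases c
        · have := hCP.2 u (by simp)
          simp [OnlyPos, hc] at this
        · have := hTU v hv
          simp [OnlyPos] at this
          simp [this] at ho

/-- Simultaneous elimination of variables `X` occurring in a single hypothesis `X ⇒ F` and otherwise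
only negatively. -/
theorem elim_neg_list (n m : ℕ) (ps : List (ℕ × FType)) (hp : ∀ p ∈ ps, m ≤ p.1 ∧ p.1 < n)
    (hps : ∀ p ∈ ps, p.2.WF ∧ ∀ j, m ≤ j → p.2.free j = false)
    (hnd : (ps.map Prod.fst).Nodup) {B : FType} (hB : B.WF) (hBi : ∀ p ∈ ps, OnlyNeg p.1 B) :
    YonedaEquiv (FType.alls n (arrs (ps.map fun p => FType.arr (var p.1) p.2) B))
      (FType.alls n (ps.foldl (fun C p => repl p.1 p.2 C) B)) := by
  induction ps generalizing B with
  | nil => exact .refl (WF_alls.2 hB)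
  | cons p ps ih =>
    simp only [List.forall_mem_cons, List.map_cons, List.nodup_cons] at hp hps hnd hBi
    have hfree := free_eq_false.1 (hps.1.2 p.1 hp.1.1)
    have hw : ∀ F ∈ ps.map fun p => FType.arr (var p.1) p.2, F.WF := by
      intro F hF
      obtain ⟨q, hq, rfl⟩ := List.mem_map.1 hF
      exact ⟨trivial, (hps.2 q hq).1⟩
    have hq : ∀ q ∈ ps, (FType.arr (var q.1) q.2).free p.1 = false := by
      intro q hq
      rw [free_eq_false]
      intro b
      have hne : p.1 ≠ q.1 := fun e => hnd.1 (List.mem_map.2 ⟨q, hq, e.symm⟩)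
      simp [occ, hne, free_eq_false.1 ((hps.2 q hq).2 p.1 hp.1.1)]
    refine (elim_neg hp.1.2 hps.1.1 (hps.1.2 p.1 hp.1.1) (WF_arrs.2 ⟨hw, hB⟩) ?_).trans ?_
    · rw [OnlyNeg, ← Bool.not_eq_true, occ_arrs]
      rintro (⟨F, hF, h⟩ | h)
      · obtain ⟨q, hq', rfl⟩ := List.mem_map.1 hF
        simp [free_eq_false.1 (hq q hq')] at h
      · have := hBi.1
        simp [OnlyNeg, h] at this
    · have e : (ps.map fun p => FType.arr (var p.1) p.2).map (repl p.1 p.2) =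
          ps.map fun p => FType.arr (var p.1) p.2 := by
        rw [List.map_map]
        exact List.map_congr_left fun q hq' => repl_eq_self (hq q hq') _
      rw [repl_arrs, e]
      refine ih hp.2 hps.2 hnd.2 (WF_repl hB hps.1.1 _) fun q hq' => ?_
      rw [OnlyNeg, ← Bool.not_eq_true]
      intro h
      rcases occ_repl h with ⟨h, -⟩ | ⟨c, -, h⟩
      · have := hBi.2 q hq'
        simp [OnlyNeg, h] at this
      · simp [free_eq_false.1 (hps.1.2 q.1 (hp.2 q hq').1)] at h

end YonedaEquiv

/-! ### Simple types and cut-free provability. -/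

namespace SType

/-- `A₁ ⇒ … ⇒ Aₖ ⇒ B`. -/
def arrs : List SType → SType → SType
  | [], B => B
  | A :: L, B => arr A (arrs L B)

/-- The variable in which a simple type ends. -/
def head : SType → ℕ
  | var i => i
  | arr _ B => B.head

/-- The premises of a simple type. -/
def premises : SType → List SType
  | var _ => []
  | arr A B => A :: B.premises

theorem arrs_premises (A : SType) : arrs A.premises (var A.head) = A := by
  induction A with
  | var i => rfl
  | arr A B _ ih => exact congrArg (arr A) ih

theorem head_arrs (L : List SType) (B : SType) : (arrs L B).head = B.head := by
  induction L with
  | nil => rfl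
  | cons A L ih => exact ih

theorem premises_arrs (L : List SType) (B : SType) :
    (arrs L B).premises = L ++ B.premises := by
  induction L with
  | nil => rfl
  | cons A L ih => exact congrArg (A :: ·) ih

/-- Cut-free provability of sequents. -/
inductive Prov : List SType → SType → Prop
  | intro {Γ : List SType} {A B : SType} : Prov (A :: Γ) B → Prov Γ (arr A B)
  | elim {Γ : List SType} {F : SType} : F ∈ Γ → (∀ B ∈ F.premises, Prov Γ B) →
      Prov Γ (var F.head)

theorem Prov.mono {Γ : List SType} {A : SType} (h : Prov Γ A) :
    ∀ {Δ : List SType}, Γ ⊆ Δ → Prov Δ A := by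
  induction h with
  | intro _ ih => exact fun hs => .intro (ih (List.cons_subset_cons _ hs))
  | elim hF _ ih => exact fun hs => .elim (hs hF) fun B hB => ih B hB hs

/-- Forcing in the Kripke model of contexts. -/
def Forces : List SType → SType → Prop
  | Γ, var i => Prov Γ (var i)
  | Γ, arr A B => ∀ Δ, Γ ⊆ Δ → Forces Δ A → Forces Δ B

theorem Forces.mono {Γ Δ : List SType} (hs : Γ ⊆ Δ) {A : SType} (h : Forces Γ A) :
    Forces Δ A := by
  cases A with
  | var i => exact Prov.mono h hs
  | arr A B => exact fun Θ hΘ => h Θ (List.Subset.trans hs hΘ)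

/-- Normalization by evaluation: reification needs reflection at the domain of an arrow, and vice
versa, so both are proved together. In the second part, `L` collects the arguments to which the
hypothesis `F` has already been applied. -/
theorem forces_iff_prov (A : SType) :
    (∀ Γ, Forces Γ A → Prov Γ A) ∧
      ∀ Γ F L, F ∈ Γ → F = arrs L A → (∀ B ∈ L, Prov Γ B) → Forces Γ A := by
  induction A with
  | var i =>
    refine ⟨fun Γ h => h, fun Γ F L hF e hL => ?_⟩
    subst e
    have := Prov.elim hF (by simpa [premises_arrs, premises] using hL)
    rwa [head_arrs] at this
  | arr A B ihA ihB =>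
    refine ⟨fun Γ h => ?_, fun Γ F L hF e hL Δ hs hA => ?_⟩
    · refine .intro (ihB.1 _ (h _ (List.subset_cons_self _ _) ?_))
      exact ihA.2 _ A [] List.mem_cons_self rfl (by simp)
    · refine ihB.2 Δ F (L ++ [A]) (hs hF) ?_ ?_
      · rw [e]
        clear e hL
        induction L with
        | nil => rfl
        | cons C L ih => exact congrArg (arr C) ih
      · intro C hC
        rcases List.mem_append.1 hC with hC | hC
        · exact (hL C hC).mono hs
        · rw [List.mem_singleton.1 hC]
          exact ihA.1 _ hA

/-- Soundness of typing for the Kripke model; with reification in the empty context it gives cut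
elimination. -/
theorem forces_of_hasType {Γ : List SType} {t : STerm} {A : SType} (h : STerm.HasType Γ t A) :
    ∀ Δ, (∀ B ∈ Γ, Forces Δ B) → Forces Δ A := by
  induction h with
  | var hx => exact fun Δ hΔ => hΔ _ (List.mem_of_getElem? hx)
  | lam _ ih =>
    intro Δ hΔ Θ hs hA
    refine ih Θ fun B hB => ?_
    rcases List.mem_cons.1 hB with rfl | hB
    · exact hA
    · exact (hΔ B hB).mono hs
  | app _ _ iht ihu => exact fun Δ hΔ => iht Δ hΔ Δ (List.Subset.refl _) (ihu Δ hΔ)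

theorem IsInhabited.prov {A : SType} (h : A.IsInhabited) : Prov [] A := by
  obtain ⟨t, ht⟩ := h
  exact (forces_iff_prov A).1 _ (forces_of_hasType ht [] (by simp))

theorem Balanced.negNonDup {A : SType} (h : A.Balanced) : A.NegNonDup := by
  have h0 : ∀ (A : SType) (b : Bool) (i : ℕ), ¬ Occurs i A → A.count b i = 0 := by
    intro A
    induction A with
    | var j => intro b i hi; simp_all [count, Occurs]
    | arr A B ihA ihB =>
      intro b i hi
      rw [Occurs, not_or] at hi
      simp [count, ihA _ _ hi.1, ihB _ _ hi.2]
  intro i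
  by_cases hi : Occurs i A
  · exact (h i hi).2.le
  · simp [h0 A false i hi]

end SType

/-! ### Adding vacuous quantifiers. -/

namespace FType

theorem rename_eq_self {A : FType} {f : ℕ → ℕ} (h : ∀ i, A.free i = true → f i = i) :
    A.rename f = A := by
  conv_rhs => rw [← subst_var A]
  conv_lhs => rw [← subst_var A, rename_subst]
  exact subst_congr A fun j b hj => congrArg var (h j (free_eq_true.2 ⟨b, hj⟩))

end FType

theorem YonedaEquiv.alls_of_le {A : FType} (hA : A.WF) {n m : ℕ}
    (h : ∀ i, A.free i = true → i < n) (hnm : n ≤ m) :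
    YonedaEquiv (FType.alls n A) (FType.alls m A) := by
  induction m, hnm using Nat.le_induction with
  | base => exact .refl (FType.WF_alls.2 hA)
  | succ m hm ih =>
    refine ih.trans ?_
    have hw := (FType.WF_alls (n := m)).2 hA
    have := BetaEtaAx.all_vacuous (FType.alls m A)
    rw [FType.shift_alls, FType.rename_eq_self] at this
    · exact .beta_eta this hw hw
    · intro i hi
      rw [FType.skip, if_pos ((h i hi).trans_le hm)]

namespace SType

/-! ### Occurrences in simple types -/

theorem occurs_iff_count {A : SType} {i : ℕ} : Occurs i A ↔ ∃ b, 0 < A.count b i := by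
  induction A with
  | var j =>
    simp only [Occurs, count, Bool.exists_bool]
    by_cases h : i = j <;> simp [h]
  | arr A B ihA ihB =>
    simp only [Occurs, count, ihA, ihB, Nat.add_pos_iff_pos_or_pos, exists_or]
    simp [or_comm]

theorem occ_toFType {A : SType} {b : Bool} {i : ℕ} :
    A.toFType.occ b i = true ↔ 0 < A.count b i := by
  induction A generalizing b with
  | var j => cases b <;> by_cases h : i = j <;> simp [toFType, FType.occ, count, h]
  | arr A B ihA ihB => simp [toFType, FType.occ, count, ihA, ihB]

theorem WF_toFType (A : SType) : A.toFType.WF := by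
  induction A with
  | var i => trivial
  | arr A B ihA ihB => exact ⟨ihA, ihB⟩

theorem free_toFType {A : SType} {i : ℕ} : A.toFType.free i = true ↔ Occurs i A := by
  simp only [FType.free_eq_true, occ_toFType, occurs_iff_count]

theorem toFType_arrs (L : List SType) (B : SType) :
    (arrs L B).toFType = FType.arrs (L.map toFType) B.toFType := by
  induction L with
  | nil => rfl
  | cons A L ih => exact congrArg (FType.arr A.toFType) ih

theorem count_arrs (L : List SType) (B : SType) (b : Bool) (i : ℕ) :
    (arrs L B).count b i = (L.map fun A => A.count (!b) i).sum + B.count b i := by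
  induction L with
  | nil => simp [arrs]
  | cons A L ih => simp [arrs, count, ih, Nat.add_assoc]

theorem count_eq_premises (A : SType) (b : Bool) (i : ℕ) :
    A.count b i = (A.premises.map fun B => B.count (!b) i).sum +
      if b = true ∧ i = A.head then 1 else 0 := by
  conv_lhs => rw [← arrs_premises A, count_arrs]
  rfl

theorem count_le_of_mem_premises {A B : SType} (h : B ∈ A.premises) (b : Bool) (i : ℕ) :
    B.count (!b) i + (if b = true ∧ i = A.head then 1 else 0) ≤ A.count b i := by
  rw [count_eq_premises A]
  have := List.le_sum_of_mem (List.mem_map.2 ⟨B, h, rfl⟩ :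
    B.count (!b) i ∈ A.premises.map fun B => B.count (!b) i)
  omega

theorem occurs_head (A : SType) : Occurs A.head A := by
  rw [occurs_iff_count]
  refine ⟨true, ?_⟩
  rw [count_eq_premises]
  simp

/-- The number of arrows. -/
def size : SType → ℕ
  | var _ => 0
  | arr A B => A.size + B.size + 1

theorem size_arrs (L : List SType) (B : SType) :
    (arrs L B).size = (L.map fun A => A.size + 1).sum + B.size := by
  induction L with
  | nil => simp [arrs]
  | cons A L ih => simp [arrs, size, ih]; omega

theorem size_lt_of_mem_premises {A B : SType} (h : B ∈ A.premises) : B.size < A.size := by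
  rw [← arrs_premises A, size_arrs]
  have := List.le_sum_of_mem (List.mem_map.2 ⟨B, h, rfl⟩ :
    B.size + 1 ∈ A.premises.map fun A => A.size + 1)
  omega

/-- The hereditary premises of a simple type that are in positive (`b = true`) or negative
(`b = false`) position. -/
def args : Bool → SType → List SType
  | _, var _ => []
  | b, arr A B => (if b then [] else [A]) ++ (args (!b) A ++ args b B)

/-- Each occurrence of a variable is the head either of the type itself or of one hereditary
premise, so occurrences can be counted through heads. -/
theorem count_eq_args (A : SType) (b : Bool) (i : ℕ) :
    A.count b i = (A.args b).countP (fun F => i = F.head) +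
      if b = true ∧ i = A.head then 1 else 0 := by
  induction A generalizing b with
  | var j =>
    simp only [count, args, head, List.countP_nil, Nat.zero_add]
    congr
  | arr A B ihA ihB =>
    cases b <;> simp [count, args, head, ihA, ihB, List.countP_cons] <;> omega

theorem NegNonDup.eq_of_head_eq {A F G : SType} (h : A.NegNonDup) (hF : F ∈ A.args false)
    (hG : G ∈ A.args false) (e : F.head = G.head) : F = G := by
  have h1 := h F.head
  rw [count_eq_args] at h1
  simp only [Bool.false_eq_true, false_and, if_false, Nat.add_zero, List.countP_eq_length_filter]
    at h1
  have hF' : F ∈ (A.args false).filter fun G => F.head = G.head := by simp [hF]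
  have hG' : G ∈ (A.args false).filter fun G => F.head = G.head := by simp [hG, e]
  match hl : (A.args false).filter fun G => F.head = G.head with
  | [] => simp [hl] at hF'
  | [C] =>
    rw [hl, List.mem_singleton] at hF' hG'
    rw [hF', hG']
  | C :: D :: l => simp [hl] at h1

theorem mem_args_of_mem_premises {A B : SType} (h : B ∈ A.premises) : B ∈ A.args false := by
  induction A with
  | var i => simp [premises] at h
  | arr A C _ ih =>
    rcases List.mem_cons.1 h with rfl | h
    · simp [args]
    · simp [args, ih h]

/-- `args` records signs relative to the type, so nesting multiplies them. -/
theorem mem_args_trans {A F G : SType} {b c : Bool} (hF : F ∈ A.args b) (hG : G ∈ F.args c) :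
    G ∈ A.args (b == c) := by
  induction A generalizing b with
  | var i => simp [args] at hF
  | arr A B ihA ihB =>
    simp only [args, List.mem_append] at hF ⊢
    rcases hF with hF | hF | hF
    · cases b
      · simp only [Bool.false_eq_true, if_false, List.mem_singleton] at hF
        subst hF
        exact Or.inr (Or.inl (by cases c <;> exact hG))
      · simp at hF
    · exact Or.inr (Or.inl (by
        have := ihA hF
        cases b <;> cases c <;> exact this))
    · exact Or.inr (Or.inr (ihB hF))

/-! ### Dependency between variables -/

/-- `y` is the head of a premise of a negative hereditary premise of `A` with head `z`. -/
def Dep (A : SType) (y z : ℕ) : Prop :=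
  ∃ F ∈ A.args false, F.head = z ∧ ∃ B ∈ F.premises, B.head = y

/-- Induction on the derivation. The hypothesis used for a goal with head z is the only negative
hereditary premise of A with head z, so every `Dep`-predecessor of z is the head of a subgoal. -/
theorem Prov.acc_dep {A : SType} (hA : A.NegNonDup) {Γ : List SType} {B : SType} (h : Prov Γ B) :
    (∀ F ∈ Γ, F ∈ A.args false) → (∀ b, B.args b ⊆ A.args b) → Acc (Dep A) B.head := by
  induction h with
  | @intro Γ C D _ ih =>
    intro hΓ hB
    refine ih ?_ ?_
    · intro F hF
      rcases List.mem_cons.1 hF with rfl | hF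
      · exact hB false (by simp [args])
      · exact hΓ F hF
    · intro b G hG
      exact hB b (by simp [args, hG])
  | @elim Γ F hF _ ih =>
    intro hΓ _
    refine Acc.intro _ ?_
    rintro y ⟨F', hF', e, B, hB, rfl⟩
    obtain rfl := hA.eq_of_head_eq hF' (hΓ F hF) e
    refine ih B hB hΓ fun b G hG => ?_
    have := mem_args_trans hF' (mem_args_trans (mem_args_of_mem_premises hB) hG)
    cases b <;> exact this

theorem not_transGen_of_acc {α : Type*} {r : α → α → Prop} {x : α} (h : Acc r x) :
    ¬ Relation.TransGen r x x := by
  have h' := h.transGen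
  induction h' with
  | intro x _ ih => exact fun hx => ih x hx (Acc.inv_of_transGen h hx) hx

/-! ### Deletion of negative premises -/

section Deletion

variable (K : ℕ → Bool)

/-- Deletion of the premises in negative position whose head is not in `K`; the flag is the
position of the type itself. -/
def del : Bool → SType → SType
  | _, var i => var i
  | true, arr A B => if K A.head then arr (del false A) (del true B) else del true B
  | false, arr A B => arr (del true A) (del false B)

/-- The premises removed by `del`. -/
def cuts : Bool → SType → List SType
  | _, var _ => []
  | true, arr A B => (if K A.head then cuts false A else [A]) ++ cuts true B
  | false, arr A B => cuts true A ++ cuts false B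

/-- Replacement of the premises removed by `del`. -/
def replCuts (r : SType → FType) : Bool → SType → FType
  | _, var i => FType.var i
  | true, arr A B =>
    FType.arr (if K A.head then replCuts r false A else r A) (replCuts r true B)
  | false, arr A B => FType.arr (replCuts r true A) (replCuts r false B)

theorem head_del (b : Bool) (A : SType) : (del K b A).head = A.head := by
  induction A generalizing b with
  | var i => cases b <;> rfl
  | arr A B _ ih =>
    cases b
    · exact ih false
    · rw [del]
      split_ifs
      · exact ih true
      · exact ih true

theorem size_del_le (b : Bool) (A : SType) : (del K b A).size ≤ A.size := by
  induction A generalizing b with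
  | var i => cases b <;> exact le_rfl
  | arr A B ihA ihB =>
    have hA := ihA (!b)
    have hB := ihB b
    cases b
    · simp only [del, size, Bool.not_false] at *
      omega
    · simp only [del, Bool.not_true] at *
      split_ifs <;> simp only [size] <;> omega

/-- Kept and removed parts are disjoint. A removed premise is negative in the whole type, hence
negative relative to `A` when `b = true` and positive when `b = false`; this explains the sign `b ^^
c`. -/
theorem count_del_add_cuts_le (b c : Bool) (A : SType) (i : ℕ) :
    (del K b A).count c i + ((cuts K b A).map fun F => F.count (b ^^ c) i).sum ≤
      A.count c i := by
  induction A generalizing b c with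
  | var j => cases b <;> simp [del, cuts]
  | arr A B ihA ihB =>
    have hA := ihA (!b) (!c)
    have hB := ihB b c
    cases b
    · simp only [del, cuts, count, List.map_append, List.sum_append, Bool.not_false] at *
      simp only [Bool.true_xor, Bool.not_not, Bool.false_xor] at *
      omega
    · simp only [del, cuts, Bool.not_true, count, Bool.true_xor, Bool.false_xor] at *
      split_ifs <;> simp [count] <;> omega

theorem count_del_le (b c : Bool) (A : SType) (i : ℕ) : (del K b A).count c i ≤ A.count c i :=
  (Nat.le_add_right _ _).trans (count_del_add_cuts_le K b c A i)

theorem head_of_mem_cuts {b : Bool} {A F : SType} (h : F ∈ cuts K b A) : K F.head = false := by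
  induction A generalizing b with
  | var i => cases b <;> simp [cuts] at h
  | arr A B ihA ihB =>
    cases b <;> simp only [cuts, List.mem_append] at h
    · exact h.elim ihA ihB
    · refine h.elim (fun h => ?_) ihB
      split_ifs at h with hK
      · exact ihA h
      · rw [List.mem_singleton.1 h]
        simpa using hK

theorem head_of_mem_args_del_neg {b : Bool} {A G : SType} (h : G ∈ (del K b A).args (!b)) :
    K G.head = true := by
  induction A generalizing b with
  | var i => cases b <;> simp [del, args] at h
  | arr A B ihA ihB =>
    cases b
    · simp only [del, args, Bool.not_false, if_true, List.nil_append, List.mem_append,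
        Bool.not_true] at h
      exact h.elim (fun h => ihA (b := true) h) (fun h => ihB (b := false) h)
    · simp only [del] at h
      split_ifs at h with hK
      · simp only [args, Bool.not_true, Bool.false_eq_true, if_false, List.mem_append,
          List.mem_singleton, Bool.not_false] at h
        rcases h with rfl | h | h
        · rwa [head_del]
        · exact ihA (b := false) h
        · exact ihB (b := true) h
      · exact ihB (b := true) h

/-- What survives in the position of `b` is a premise of a kept premise, or of the type itself if
that is in negative position. With `b = true` only the former remains, so the head is a
`Dep`-predecessor of a variable in `K`. -/
theorem head_of_mem_args_del_pos {b : Bool} {A G : SType} (h : G ∈ (del K b A).args b) :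
    (b = false ∧ ∃ B ∈ A.premises, B.head = G.head) ∨
      ∃ F ∈ A.args (!b), K F.head = true ∧ ∃ B ∈ F.premises, B.head = G.head := by
  induction A generalizing b with
  | var i => cases b <;> simp [del, args] at h
  | arr A B ihA ihB =>
    cases b
    · simp only [del, args, Bool.not_false, Bool.false_eq_true, if_false, List.mem_append,
        List.mem_singleton] at h
      rcases h with rfl | h | h
      · exact Or.inl ⟨rfl, A, by simp [premises], (head_del K true A).symm⟩
      · rcases ihA h with ⟨h, -⟩ | ⟨F, hF, h⟩
        · cases h
        · exact Or.inr ⟨F, by simp at hF; simp [args, hF], h⟩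
      · rcases ihB h with ⟨-, C, hC, h⟩ | ⟨F, hF, h⟩
        · exact Or.inl ⟨rfl, C, by simp [premises, hC], h⟩
        · exact Or.inr ⟨F, by simp at hF; simp [args, hF], h⟩
    · refine Or.inr ?_
      have hB : G ∈ (del K true B).args true → ∃ F ∈ (arr A B).args (!true),
          K F.head = true ∧ ∃ B ∈ F.premises, B.head = G.head := by
        intro h
        rcases ihB h with ⟨h, -⟩ | ⟨F, hF, h⟩
        · cases h
        · exact ⟨F, by simp at hF; simp [args, hF], h⟩
      simp only [del] at h
      split_ifs at h with hK
      · simp only [args, Bool.not_true, if_true, List.mem_append, List.nil_append] at h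
        rcases h with h | h
        · rcases ihA h with ⟨-, C, hC, h⟩ | ⟨F, hF, h⟩
          · exact ⟨A, by simp [args], hK, C, hC, h⟩
          · exact ⟨F, by simp at hF; simp [args, hF], h⟩
        · exact hB h
      · exact hB h

theorem replCuts_toFType (b : Bool) (A : SType) : replCuts K toFType b A = A.toFType := by
  induction A generalizing b with
  | var i => cases b <;> rfl
  | arr A B ihA ihB => cases b <;> simp [replCuts, toFType, ihA, ihB]

theorem replCuts_congr {r s : SType → FType} {b : Bool} {A : SType}
    (h : ∀ F ∈ cuts K b A, r F = s F) : replCuts K r b A = replCuts K s b A := by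
  induction A generalizing b with
  | var i => cases b <;> rfl
  | arr A B ihA ihB =>
    cases b <;> simp only [cuts, List.mem_append, or_imp, forall_and] at h
    · rw [replCuts, replCuts, ihA h.1, ihB h.2]
    · rw [replCuts, replCuts, ihB h.2]
      split_ifs with hK
      · rw [ihA (by simpa [hK] using h.1)]
      · rw [h.1 A (by simp [hK])]

theorem WF_replCuts {r : SType → FType} (hr : ∀ F, (r F).WF) (b : Bool) (A : SType) :
    (replCuts K r b A).WF := by
  induction A generalizing b with
  | var i => cases b <;> trivial
  | arr A B ihA ihB =>
    cases b
    · exact ⟨ihA _, ihB _⟩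
    · refine ⟨?_, ihB _⟩
      split_ifs
      · exact ihA _
      · exact hr A

theorem repl_replCuts {A : SType} {t : ℕ} (ht : ¬ Occurs t A) (T : FType) (r : SType → FType)
    (b : Bool) :
    FType.repl t T (replCuts K r b A) = replCuts K (fun F => FType.repl t T (r F)) b A := by
  have harr : ∀ A B : FType, FType.repl t T (FType.arr A B) =
      FType.arr (FType.repl t T A) (FType.repl t T B) := fun A B => rfl
  induction A generalizing b with
  | var i =>
    have : i ≠ t := fun e => ht e.symm
    cases b <;> exact FType.repl_var_of_ne this T
  | arr A B ihA ihB =>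
    rw [Occurs, not_or] at ht
    cases b
    · rw [replCuts, replCuts, harr, ihA ht.1, ihB ht.2]
    · rw [replCuts, replCuts, harr, ihB ht.2, apply_ite (FType.repl t T), ihA ht.1]

theorem occ_replCuts {A : SType} {r : SType → FType} {b c : Bool} {i : ℕ}
    (h : (replCuts K r b A).occ c i = true) :
    0 < (del K b A).count c i ∨ ∃ F ∈ cuts K b A, (r F).occ (b ^^ c) i = true := by
  induction A generalizing b c with
  | var j =>
    left
    cases b <;> exact occ_toFType (A := var j).1 h
  | arr A B ihA ihB =>
    cases b
    · simp only [replCuts, FType.occ, Bool.or_eq_true] at h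
      simp only [del, cuts, count, List.mem_append, Nat.add_pos_iff_pos_or_pos]
      rcases h with h | h
      · rcases ihA h with h | ⟨F, hF, h⟩
        · exact Or.inl (Or.inl h)
        · exact Or.inr ⟨F, Or.inl hF, by simpa using h⟩
      · rcases ihB h with h | ⟨F, hF, h⟩
        · exact Or.inl (Or.inr h)
        · exact Or.inr ⟨F, Or.inr hF, h⟩
    · simp only [replCuts, FType.occ, Bool.or_eq_true] at h
      simp only [del, cuts, List.mem_append]
      split_ifs at h ⊢ with hK
      · simp only [count, Nat.add_pos_iff_pos_or_pos]
        rcases h with h | h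
        · rcases ihA h with h | ⟨F, hF, h⟩
          · exact Or.inl (Or.inl h)
          · exact Or.inr ⟨F, Or.inl hF, by simpa using h⟩
        · rcases ihB h with h | ⟨F, hF, h⟩
          · exact Or.inl (Or.inr h)
          · exact Or.inr ⟨F, Or.inr hF, h⟩
      · rcases h with h | h
        · exact Or.inr ⟨A, by simp, by simpa using h⟩
        · rcases ihB h with h | ⟨F, hF, h⟩
          · exact Or.inl h
          · exact Or.inr ⟨F, Or.inr hF, h⟩

theorem replCuts_one_equiv (b : Bool) (A : SType) :
    YonedaEquiv (replCuts K (fun _ => FType.one) b A) (del K b A).toFType := by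
  induction A generalizing b with
  | var i => cases b <;> exact .refl trivial
  | arr A B ihA ihB =>
    cases b
    · exact .arr (ihA _) (ihB _)
    · rw [replCuts, del]
      split_ifs
      · exact .arr (ihA _) (ihB _)
      · have hw := (ihB true).wf.1
        exact .trans (.beta_eta (.one_arr _) ⟨trivial, hw⟩ hw) (ihB _)

end Deletion

/-! ### Deletion of premises as an isomorphism. -/

theorem foldl_repl_replCuts (K : ℕ → Bool) {A : SType} (b : Bool) (ps : List (ℕ × FType))
    (hps : ∀ p ∈ ps, ¬ Occurs p.1 A) (r : SType → FType) :
    ps.foldl (fun C p => FType.repl p.1 p.2 C) (replCuts K r b A) =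
      replCuts K (fun F => ps.foldl (fun C p => FType.repl p.1 p.2 C) (r F)) b A := by
  induction ps generalizing r with
  | nil => rfl
  | cons p ps ih =>
    rw [List.forall_mem_cons] at hps
    rw [List.foldl_cons, repl_replCuts K hps.1, ih hps.2]
    rfl

theorem foldl_repl_eq_self {T : FType} (ps : List (ℕ × FType))
    (h : ∀ p ∈ ps, T.free p.1 = false) :
    ps.foldl (fun C p => FType.repl p.1 p.2 C) T = T := by
  induction ps with
  | nil => rfl
  | cons p ps ih =>
    rw [List.forall_mem_cons] at h
    rw [List.foldl_cons, FType.repl_eq_self h.1, ih h.2]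

/-- Successive substitutions act as a simultaneous one here, because the codes are distinct and do
not occur in the type substituted. -/
theorem foldl_repl_var {L : List SType} {code : SType → ℕ} {f : SType → FType} {F : SType}
    (hF : F ∈ L) (hcode : ∀ G ∈ L, code F = code G → F = G)
    (hf : ∀ G ∈ L, (f F).free (code G) = false) :
    (L.map fun G => (code G, f G)).foldl (fun C p => FType.repl p.1 p.2 C)
      (FType.var (code F)) = f F := by
  induction L with
  | nil => simp at hF
  | cons G L ih =>
    rw [List.forall_mem_cons] at hcode hf
    rw [List.map_cons, List.foldl_cons]
    by_cases e : code F = code G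
    · obtain rfl := hcode.1 e
      rw [FType.repl_var_self]
      refine foldl_repl_eq_self _ fun p hp => ?_
      obtain ⟨H, hH, rfl⟩ := List.mem_map.1 hp
      exact hf.2 H hH
    · rw [FType.repl_var_of_ne e]
      refine ih ?_ hcode.2 hf.2
      rcases List.mem_cons.1 hF with rfl | hF
      · exact absurd rfl e
      · exact hF

/-- In a negatively non-duplicated type, the head of a deleted premise does not occur negatively in
the premises of the deleted premises. -/
theorem NegNonDup.count_premise_cuts {A : SType} (hA : A.NegNonDup) (K : ℕ → Bool) {F G C : SType}
    (hF : F ∈ cuts K true A) (hG : G ∈ cuts K true A) (hC : C ∈ F.premises) :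
    C.count false G.head = 0 := by
  by_contra hne
  have h1 := (count_del_add_cuts_le K true false A G.head).trans (hA G.head)
  simp only [Bool.xor_false] at h1
  have hFc := count_le_of_mem_premises hC true G.head
  have hGc := count_eq_premises G true G.head
  simp only [Bool.not_true, true_and, if_true] at hFc hGc
  by_cases e : F = G
  · subst e
    have := List.le_sum_of_mem (List.mem_map.2 ⟨F, hF, rfl⟩ :
      F.count true F.head ∈ (cuts K true A).map fun H => H.count true F.head)
    simp only [if_true] at hFc
    omega
  · classical
    have hp := (List.perm_cons_erase hF).map fun H => H.count true G.head
    rw [hp.sum_eq, List.map_cons, List.sum_cons] at h1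
    have := List.le_sum_of_mem (List.mem_map.2 ⟨G, (List.mem_erase_of_ne (Ne.symm e)).2 hG, rfl⟩ :
      G.count true G.head ∈ ((cuts K true A).erase F).map fun H => H.count true G.head)
    omega

theorem arrs_clauses_one_equiv (L : List ℕ) {B : FType} (hB : B.WF) :
    YonedaEquiv (FType.arrs (L.map fun t => FType.arr (FType.var t) FType.one) B) B := by
  induction L with
  | nil => exact .refl hB
  | cons t L ih =>
    refine .trans (.arr (.arr_one trivial) ih) ?_
    exact .beta_eta (.one_arr _) ⟨trivial, hB⟩ hB

/-- Premises in negative position can be deleted if no variable remains that is not in `K`. -/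
theorem NegNonDup.alls_del {A : SType} (hA : A.NegNonDup) (K : ℕ → Bool) {n : ℕ}
    (hn : ∀ i, Occurs i A → i < n) (hK : ∀ i, Occurs i (del K true A) → K i = true) :
    ∃ N, n ≤ N ∧
      YonedaEquiv (FType.alls N A.toFType) (FType.alls N (del K true A).toFType) := by
  classical
  set L := (cuts K true A).dedup with hL
  have hmem : ∀ {F}, F ∈ L ↔ F ∈ cuts K true A := List.mem_dedup
  -- The fresh variables are those from `n` on, one for each distinct removed premise; equal
  -- premises share a variable.
  set code : SType → ℕ := fun F => n + L.idxOf F with hcode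
  have hinj : ∀ F ∈ L, ∀ G ∈ L, code F = code G → F = G := by
    intro F hF G hG e
    exact (List.idxOf_inj hF).1 (Nat.add_left_cancel e)
  have hlt : ∀ F ∈ L, code F < n + L.length := fun F hF =>
    Nat.add_lt_add_left (List.idxOf_lt_length_iff.2 hF) n
  have hge : ∀ F, n ≤ code F := fun F => Nat.le_add_right _ _
  have hocc : ∀ F ∈ L, ∀ i, Occurs i F → i < n := by
    intro F hF i hi
    refine hn i ?_
    rw [occurs_iff_count] at hi ⊢
    obtain ⟨b, hb⟩ := hi
    have h := count_del_add_cuts_le K true (!b) A i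
    have h' := List.le_sum_of_mem (List.mem_map.2 ⟨F, hmem.1 hF, rfl⟩ :
      F.count (true ^^ !b) i ∈ (cuts K true A).map fun F => F.count (true ^^ !b) i)
    refine ⟨!b, ?_⟩
    simp only [Bool.true_xor, Bool.not_not] at h h'
    omega
  have hfresh : ∀ j, n ≤ j → ¬ Occurs j A := fun j hj h => absurd (hn j h) (by omega)
  have hfreeF : ∀ F ∈ L, ∀ j, n ≤ j → F.toFType.free j = false := by
    intro F hF j hj
    rw [← Bool.not_eq_true, free_toFType]
    exact fun h => absurd (hocc F hF j h) (by omega)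
  refine ⟨n + L.length, Nat.le_add_right _ _, ?_⟩
  set N := n + L.length
  set A₀ := replCuts K (fun F => FType.var (code F)) true A with hA₀
  have hA₀w : A₀.WF := WF_replCuts K (r := fun F => .var (code F)) (fun _ => trivial) true A
  have hA₀n : ∀ F ∈ L, FType.OnlyNeg (code F) A₀ := by
    intro F hF
    rw [FType.OnlyNeg, ← Bool.not_eq_true]
    intro h
    rcases occ_replCuts K h with h | ⟨G, -, h⟩
    · exact hfresh _ (hge F) (occurs_iff_count.2 ⟨true, h.trans_le (count_del_le K _ _ _ _)⟩)
    · simp [FType.occ] at h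
  have hA₀f : ∀ F ∈ L, A₀.free F.head = false := by
    intro F hF
    rw [FType.free_eq_false]
    intro b
    rw [← Bool.not_eq_true]
    intro h
    rcases occ_replCuts K h with h | ⟨G, -, h⟩
    · have := hK _ (occurs_iff_count.2 ⟨b, h⟩)
      simp [head_of_mem_cuts K (hmem.1 hF)] at this
    · simp only [FType.occ, Bool.and_eq_true, decide_eq_true_eq] at h
      have h' : F.head < n := hocc F hF _ (occurs_head F)
      have := hge G
      omega
  -- Used twice: with `f = toFType` it unfolds to the original type, and with `f` constantly 1 to
  -- the type with the premises deleted. The two meet at `A₀`, in which the removed premises are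
  -- bare fresh variables.
  have subst_equiv : ∀ f : SType → FType,
      (∀ F ∈ L, (f F).WF ∧ ∀ j, n ≤ j → (f F).free j = false) →
      YonedaEquiv (FType.alls N (FType.arrs (L.map fun F => FType.arr (.var (code F)) (f F)) A₀))
        (FType.alls N (replCuts K f true A)) := by
    intro f hf
    have h := YonedaEquiv.elim_neg_list N n (L.map fun F => (code F, f F)) ?_ ?_ ?_ hA₀w ?_
    · rw [foldl_repl_replCuts, List.map_map] at h
      · rwa [replCuts_congr K fun F hF => foldl_repl_var (hmem.2 hF)
          (hinj F (hmem.2 hF)) fun G _ => (hf F (hmem.2 hF)).2 _ (hge G)] at h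
      · intro p hp
        obtain ⟨F, hF, rfl⟩ := List.mem_map.1 hp
        exact hfresh _ (hge F)
    · intro p hp
      obtain ⟨F, hF, rfl⟩ := List.mem_map.1 hp
      exact ⟨hge F, hlt F hF⟩
    · intro p hp
      obtain ⟨F, hF, rfl⟩ := List.mem_map.1 hp
      exact hf F hF
    · rw [List.map_map]
      exact (List.nodup_dedup _).map_on fun F hF G hG e => hinj F hF G hG e
    · intro p hp
      obtain ⟨F, hF, rfl⟩ := List.mem_map.1 hp
      exact hA₀n F hF
  have h₁ := subst_equiv toFType fun F hF => ⟨WF_toFType F, hfreeF F hF⟩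
  have h₂ := subst_equiv (fun _ => FType.one) fun F _ => ⟨trivial, fun j _ => rfl⟩
  rw [replCuts_toFType] at h₁
  have h₃ := (arrs_clauses_one_equiv (L.map code) hA₀w).alls N
  rw [List.map_map] at h₃
  have h₄ := (replCuts_one_equiv K true A).alls N
  refine h₁.symm.trans (.trans ?_ ((h₃.symm.trans h₂).trans h₄))
  -- The clause t ⇒ F is itself a hypothesis with the head of `F`. This head lies outside `K`, so it
  -- is absent from `A₀`; by non-duplication it is not negative in the premises of any clause.
  have h₅ := YonedaEquiv.alls_arrs_remove N (L.map head) ?_ hA₀w ?_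
    (L.map fun F => (FType.var (code F) :: F.premises.map toFType, F.head)) ?_ ?_
  · rw [List.map_map] at h₅
    convert h₅ using 4
    funext F
    rw [Function.comp_apply, FType.arrs]
    conv_lhs => rw [← arrs_premises F, toFType_arrs, arrs_premises]
    rfl
  · intro u hu
    obtain ⟨F, hF, rfl⟩ := List.mem_map.1 hu
    exact (hocc F hF _ (occurs_head F)).trans_le (Nat.le_add_right _ _)
  · intro u hu
    obtain ⟨F, hF, rfl⟩ := List.mem_map.1 hu
    exact hA₀f F hF
  · intro h hh
    obtain ⟨F, hF, rfl⟩ := List.mem_map.1 hh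
    exact List.mem_map.2 ⟨F, hF, rfl⟩
  · intro h hh C hC
    obtain ⟨F, hF, rfl⟩ := List.mem_map.1 hh
    rcases List.mem_cons.1 hC with rfl | hC
    · exact ⟨trivial, fun u _ => by simp [FType.OnlyPos, FType.occ]⟩
    · obtain ⟨D, hD, rfl⟩ := List.mem_map.1 hC
      refine ⟨WF_toFType D, fun u hu => ?_⟩
      obtain ⟨G, hG, rfl⟩ := List.mem_map.1 hu
      rw [FType.OnlyPos, ← Bool.not_eq_true, occ_toFType,
        hA.count_premise_cuts K (hmem.1 hF) (hmem.1 hG) hD]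
      exact lt_irrefl 0

/-! ### Provability -/

/-- A goal with head in `K` is solved by a hypothesis with the same head, and closure of `K` under
`Dep` keeps the subgoals in `K`. Hypotheses with head outside `K` are therefore never used. -/
theorem Prov.del {A : SType} (K : ℕ → Bool) (hK : ∀ y z, Dep A y z → K z = true → K y = true)
    {Γ : List SType} {B : SType} (h : Prov Γ B) :
    (∀ F ∈ Γ, F ∈ A.args false) → (∀ b, B.args b ⊆ A.args b) → K B.head = true →
      ∀ Δ, (∀ F ∈ Γ, K F.head = true → del K false F ∈ Δ) → Prov Δ (del K true B) := by
  have hpre : ∀ F B : SType, B ∈ (SType.del K false F).premises →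
      ∃ C ∈ F.premises, B = SType.del K true C := by
    intro F B hB
    induction F with
    | var i => simp [SType.del, premises] at hB
    | arr C D _ ih =>
      rw [SType.del, premises] at hB
      rcases List.mem_cons.1 hB with rfl | hB
      · exact ⟨C, by simp [premises], rfl⟩
      · obtain ⟨E, hE, e⟩ := ih hB
        exact ⟨E, by simp [premises, hE], e⟩
  induction h with
  | @intro Γ C D _ ih =>
    intro hΓ hB hk Δ hΔ
    have hΓ' : ∀ F ∈ C :: Γ, F ∈ A.args false := by
      intro F hF
      rcases List.mem_cons.1 hF with rfl | hF
      · exact hB false (by simp [args])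
      · exact hΓ F hF
    have hD : ∀ b, D.args b ⊆ A.args b := fun b G hG => hB b (by simp [args, hG])
    rw [SType.del]
    split_ifs with hC
    · refine .intro (ih hΓ' hD hk _ fun F hF hFk => ?_)
      rcases List.mem_cons.1 hF with rfl | hF
      · simp
      · exact List.mem_cons_of_mem _ (hΔ F hF hFk)
    · refine ih hΓ' hD hk _ fun F hF hFk => ?_
      rcases List.mem_cons.1 hF with rfl | hF
      · exact absurd hFk hC
      · exact hΔ F hF hFk
  | @elim Γ F hF _ ih =>
    intro hΓ _ hk Δ hΔ
    rw [SType.del, ← head_del K false F]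
    refine .elim (hΔ F hF hk) fun B hB => ?_
    obtain ⟨C, hC, rfl⟩ := hpre F B hB
    refine ih C hC hΓ (fun b G hG => ?_) (hK _ _ ⟨F, hΓ F hF, rfl, C, hC, rfl⟩ hk) Δ hΔ
    have := mem_args_trans (hΓ F hF) (mem_args_trans (mem_args_of_mem_premises hC) hG)
    cases b <;> exact this

theorem Prov.premises_head {A : SType} {Γ : List SType} (h : Prov Γ A) :
    Prov (A.premises ++ Γ) (var A.head) := by
  induction A generalizing Γ with
  | var i => exact h
  | arr A B _ ih =>
    cases h with
    | intro h =>
      refine (ih h).mono ?_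
      intro F hF
      simp only [premises, List.cons_append, List.mem_append, List.mem_cons] at hF ⊢
      tauto

theorem Prov.exists_mem_of_var {Γ : List SType} {x : ℕ} (h : Prov Γ (var x)) :
    ∃ F ∈ Γ, F.head = x ∧ ∀ B ∈ F.premises, Prov Γ B := by
  cases h with
  | elim hF hFp => exact ⟨_, hF, rfl, hFp⟩

theorem Prov.arrs {L Γ : List SType} {A : SType} (h : Prov (L ++ Γ) A) :
    Prov Γ (arrs L A) := by
  induction L generalizing Γ with
  | nil => exact h
  | cons B L ih =>
    refine .intro (ih (h.mono ?_))
    intro F hF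
    simp only [List.cons_append, List.mem_append, List.mem_cons] at hF ⊢
    tauto

theorem occurs_of_mem_premises {A B : SType} (h : B ∈ A.premises) {i : ℕ} (hi : Occurs i B) :
    Occurs i A := by
  rw [occurs_iff_count] at hi ⊢
  obtain ⟨b, hb⟩ := hi
  refine ⟨!b, ?_⟩
  have := count_le_of_mem_premises h (!b) i
  rw [Bool.not_not] at this
  omega

/-- Hypotheses whose head does not occur elsewhere are not needed. -/
theorem Prov.strengthen {x : ℕ} {Γ : List SType} {B : SType} (h : Prov Γ B) :
    ¬ Occurs x B → ∀ Δ, (∀ F ∈ Γ, F.head = x ∨ F ∈ Δ) → (∀ F ∈ Δ, ¬ Occurs x F) →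
      Prov Δ B := by
  induction h with
  | @intro Γ C D _ ih =>
    intro hB Δ hΓ hΔ
    rw [Occurs, not_or] at hB
    refine .intro (ih hB.2 _ ?_ ?_)
    · intro F hF
      rcases List.mem_cons.1 hF with rfl | hF
      · exact Or.inr List.mem_cons_self
      · exact (hΓ F hF).imp_right (List.mem_cons_of_mem _)
    · intro F hF
      rcases List.mem_cons.1 hF with rfl | hF
      · exact hB.1
      · exact hΔ F hF
  | @elim Γ F hF _ ih =>
    intro hx Δ hΓ hΔ
    have hFΔ : F ∈ Δ := (hΓ F hF).resolve_left fun e => hx e.symm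
    refine .elim hFΔ fun B hB => ih B hB (fun h => ?_) Δ hΓ hΔ
    exact hΔ F hFΔ (occurs_of_mem_premises hB h)

/-! ### The main argument -/

theorem NegNonDup.alls_equiv_one {A : SType} (hA : A.NegNonDup) (hp : Prov [] A) {n : ℕ}
    (hn : ∀ i, Occurs i A → i < n) : YonedaEquiv (FType.alls n A.toFType) FType.one := by
  induction hs : A.size using Nat.strong_induction_on generalizing A n with
  | _ s ih =>
  subst hs
  classical
  have hacc : Acc (Dep A) A.head := hp.acc_dep hA (by simp) fun b => List.Subset.refl _
  set x := A.head with hx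
  -- The smallest set that contains `x` and is closed under `Dep`-predecessors.
  set K : ℕ → Bool := fun y => decide (Relation.ReflTransGen (Dep A) y x) with hKdef
  have hKdep : ∀ y z, Dep A y z → K z = true → K y = true := by
    intro y z hyz hz
    simp only [hKdef, decide_eq_true_eq] at hz ⊢
    exact .head hyz hz
  have hKx : K x = true := by simp [hKdef, Relation.ReflTransGen.refl]
  set A' := SType.del K true A with hA'
  have hhead : A'.head = x := head_del K true A
  have hargs : ∀ G ∈ A'.args true, ∃ z, Dep A G.head z ∧ K z = true := by
    intro G hG
    rcases head_of_mem_args_del_pos K hG with ⟨h, -⟩ | ⟨F, hF, hFK, hB⟩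
    · cases h
    · exact ⟨F.head, ⟨F, hF, rfl, hB⟩, hFK⟩
  -- An occurrence other than the head of `A'` is the head of a hereditary premise: a negative one
  -- was kept because its head is in `K`, and the head of a positive one is a `Dep`-predecessor of a
  -- variable in `K`.
  have hocc : ∀ i, Occurs i A' → K i = true := by
    intro i hi
    obtain ⟨b, hb⟩ := occurs_iff_count.1 hi
    rw [count_eq_args] at hb
    by_cases hix : i = x
    · rw [hix, hKx]
    · rw [hhead, if_neg (fun h => hix h.2), Nat.add_zero, List.countP_pos_iff] at hb
      obtain ⟨G, hG, e⟩ := hb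
      rw [of_decide_eq_true e]
      cases b
      · exact head_of_mem_args_del_neg K (b := true) hG
      · obtain ⟨z, hz, hzK⟩ := hargs G hG
        exact hKdep _ _ hz hzK
  -- A positive hereditary premise with head `x` would give a `Dep`-step from `x` to some z in `K`,
  -- and z leads back to `x`: a cycle through an accessible point.
  have hposx : A'.count true x = 1 := by
    rw [count_eq_args, hhead, if_pos ⟨rfl, rfl⟩, List.countP_eq_zero.2]
    intro G hG e
    obtain ⟨z, hz, hzK⟩ := hargs G hG
    rw [← of_decide_eq_true e] at hz
    exact not_transGen_of_acc hacc (.head' hz (of_decide_eq_true hzK))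
  have hA'n : A'.NegNonDup := fun i => (count_del_le K true false A i).trans (hA i)
  have hA'p : Prov [] A' :=
    hp.del K hKdep (by simp) (fun b => List.Subset.refl _) hKx [] (by simp)
  obtain ⟨N, hnN, hN⟩ := hA.alls_del K hn hocc
  have hfree : ∀ i, A.toFType.free i = true → i < n := fun i hi => hn i (free_toFType.1 hi)
  refine (YonedaEquiv.alls_of_le (WF_toFType A) hfree hnN).trans (hN.trans ?_)
  have hA'occ : ∀ i, Occurs i A' → i < N := by
    intro i hi
    obtain ⟨b, hb⟩ := occurs_iff_count.1 hi
    exact (hn i (occurs_iff_count.2 ⟨b, hb.trans_le (count_del_le K _ _ _ _)⟩)).trans_le hnN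
  have hpv := hA'p.premises_head
  rw [List.append_nil, hhead] at hpv
  have hA'e : A' = SType.arrs A'.premises (var x) := by rw [← hhead, arrs_premises]
  set Γ := A'.premises with hΓ
  obtain ⟨F, hF, hFx, hFp⟩ := hpv.exists_mem_of_var
  have hperm := List.perm_cons_erase hF
  set Γ' := Γ.erase F with hΓ'
  have hcount : ∀ (b : Bool) (i : ℕ), A'.count b i = F.count (!b) i +
      (Γ'.map fun C => C.count (!b) i).sum + (var x).count b i := by
    intro b i
    rw [hA'e, count_arrs, (hperm.map _).sum_eq, List.map_cons, List.sum_cons]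
  -- The head of `A'` and the head of `F` use up the one positive and the one negative occurrence of
  -- `x`, so `x` is absent from the premises of `F` and from `Γ'`.
  have hxF : ∀ B ∈ F.premises, ¬ Occurs x B := by
    intro B hB h
    obtain ⟨b, hb⟩ := occurs_iff_count.1 h
    have hle := count_le_of_mem_premises hB (!b) x
    rw [Bool.not_not, hFx] at hle
    cases b
    · have h1 := hcount false x
      have h2 := hA'n x
      simp at h1 hle
      omega
    · have h1 := hcount true x
      simp [count] at h1 hle
      omega
  have hxΓ : ∀ C ∈ Γ', ¬ Occurs x C := by
    intro C hC h
    obtain ⟨b, hb⟩ := occurs_iff_count.1 h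
    have h1 := hcount (!b) x
    have hle := List.le_sum_of_mem (List.mem_map.2 ⟨C, hC, rfl⟩ :
      C.count b x ∈ Γ'.map fun C => C.count b x)
    rw [Bool.not_not] at h1
    cases b
    · simp [count] at h1
      omega
    · have h2 := hA'n x
      have h3 := count_eq_premises F true x
      simp [hFx] at h1 h3
      omega
  have hwL : ∀ C ∈ Γ'.map toFType, C.WF := by
    intro C hC
    obtain ⟨D, -, rfl⟩ := List.mem_map.1 hC
    exact WF_toFType D
  have h₁ : YonedaEquiv A'.toFType
      (FType.arr F.toFType (FType.arrs (Γ'.map toFType) (FType.var x))) := by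
    have hw : ∀ C ∈ Γ.map toFType, C.WF := by
      intro C hC
      obtain ⟨D, -, rfl⟩ := List.mem_map.1 hC
      exact WF_toFType D
    conv_lhs => rw [hA'e, toFType_arrs]
    exact YonedaEquiv.arrs_perm (hperm.map toFType) hw trivial
  refine (h₁.alls N).trans ?_
  have hxFree : ∀ C : SType, ¬ Occurs x C → C.toFType.free x = false := by
    intro C hC
    rwa [← Bool.not_eq_true, free_toFType]
  have hxN : x < N := hA'occ x (hhead ▸ occurs_head A')
  obtain ⟨T, -, -, hT, h₂⟩ := YonedaEquiv.elim_pos hxN [F.premises.map toFType]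
    (B := FType.arrs (Γ'.map toFType) (FType.var x))
    (by
      intro h hh C hC
      rw [List.mem_singleton.1 hh] at hC
      obtain ⟨D, hD, rfl⟩ := List.mem_map.1 hC
      exact ⟨WF_toFType D, FType.free_eq_false.1 (hxFree D (hxF D hD)) _⟩)
    (FType.WF_arrs.2 ⟨hwL, trivial⟩)
    (by
      rw [FType.OnlyPos, ← Bool.not_eq_true, FType.occ_arrs]
      rintro (⟨C, hC, h⟩ | h)
      · obtain ⟨D, hD, rfl⟩ := List.mem_map.1 hC
        simp [FType.free_eq_false.1 (hxFree D (hxΓ D hD))] at h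
      · simp [FType.occ] at h)
  have hFe : F.toFType = FType.arrs (F.premises.map toFType) (FType.var x) := by
    conv_lhs => rw [← arrs_premises F, toFType_arrs, hFx]
    rfl
  have hΓe : (Γ'.map toFType).map (FType.repl x T) = Γ'.map toFType := by
    rw [List.map_map]
    exact List.map_congr_left fun C hC => FType.repl_eq_self (hxFree C (hxΓ C hC)) T
  -- As `x` is not free in the premises of `F`, no μ appears and `T` is their product; it replaces
  -- only the final `x`.
  rw [FType.repl_arrs, hΓe, FType.repl_var_self, hT] at h₂
  · rw [List.map_singleton, List.map_singleton, FType.arrs, FType.arrs, ← hFe, FType.sums] at h₂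
    refine h₂.trans (YonedaEquiv.alls_arrs_prods_eq_one N hwL ?_)
    intro C hC
    obtain ⟨B, hB, rfl⟩ := List.mem_map.1 hC
    rw [← toFType_arrs]
    have hle : ∀ (b : Bool) (i : ℕ), (SType.arrs Γ' B).count b i ≤ A'.count b i := by
      intro b i
      have h1 := count_le_of_mem_premises hB (!b) i
      rw [Bool.not_not] at h1
      rw [count_arrs, hcount]
      omega
    refine ih _ ?_ (fun i => (hle false i).trans (hA'n i)) ?_ ?_ rfl
    · have h1 := size_del_le K true A
      have h2 := size_lt_of_mem_premises hB
      rw [← hA', hA'e, size_arrs, (hperm.map _).sum_eq, List.map_cons, List.sum_cons] at h1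
      rw [size_arrs]
      omega
    · refine Prov.arrs ?_
      rw [List.append_nil]
      -- `F` can be dropped from the context: its head `x` occurs neither in the goal nor in `Γ'`.
      refine (hFp B hB).strengthen (hxF B hB) Γ' (fun G hG => ?_) hxΓ
      rcases List.mem_cons.1 (hperm.mem_iff.1 hG) with rfl | hG
      · exact Or.inl hFx
      · exact Or.inr hG
    · intro i hi
      obtain ⟨b, hb⟩ := occurs_iff_count.1 hi
      exact hA'occ i (occurs_iff_count.2 ⟨b, hb.trans_le (hle b i)⟩)
  · intro h hh C hC
    rw [List.mem_singleton.1 hh] at hC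
    obtain ⟨D, hD, rfl⟩ := List.mem_map.1 hC
    exact hxFree D (hxF D hD)

end SType

theorem proposition1 (n : ℕ) (A : SType)
    (hfree : ∀ i, SType.Occurs i A → i < n)
    (hinh : A.IsInhabited)
    (hA : A.Balanced ∨ A.NegNonDup) :
    YonedaEquiv (FType.alls n A.toFType) FType.one :=
  (hA.elim SType.Balanced.negNonDup id).alls_equiv_one hinh.prov hfree
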